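/- Let $Y_1,Y_2,\dots$ be independent copies of a real random variable with continuous distribution function $G$. Put $l_G=\inf\{x: G(x)>0\}$ and $r_G=\sup\{x: G(x)<1\}$ (possibly infinite). Let $L(1)=1$, $L(n)=\min\{j>L(n-1): Y_j>Y_{L(n-1)}\}$ for $n>1$, and let $Y(n)=Y_{L(n)}$ be the $n$-th upper record value. Let $1\le k\le n-1$ and let $g$ be a positive, continuous, strictly decreasing function on $(l_G,r_G)$ such that $g(y)^{-1/(k+1)}\to\infty$ as $y\to r_G^-$. Put $\tau=\lim_{y\to l_G^+} g(y)^{-1/(k+1)}\in[0,\infty)$. Then $$E\big[g(Y(n))\,\big|\,Y(n-k)=s,\ Y(n+1)=t\big]=g(t)^{k/(k+1)}\,g(s)^{1/(k+1)}\qquad(l_G<s<t<r_G)$$ holds if and only if there is a constant $c>0$ with $$G(y)=1-\exp\!\big(-c\,\{g(y)^{-1/(k+1)}-\tau\}\big)\qquad(l_G<y<r_G).$$ Here the conditional expectation is the integral of $g$ with respect to the regular conditional law of $Y(n)$ given $(Y(n-k),Y(n+1))$, and the identity is understood for almost every $(s,t)$ with respect to the joint law of $(Y(n-k),Y(n+1))$.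 -/

import Mathlib

open MeasureTheory ProbabilityTheory Filter Topology

noncomputable section

/-- Upper record times of a real sequence whose first observation is `x 0`. The record number `n`
is counted from `1`: the first record time is the time of the first observation, and the record
time number `n + 1` is the first later time at which the record value number `n` is exceeded.
(The number `0` is not used. The set below is almost surely nonempty for the sequences
of independent variables with a common continuous law.) -/
def recordTime (x : ℕ → ℝ) : ℕ → ℕ
  | 0 => 0
  | 1 => 0
  | n + 2 => sInf {j : ℕ | recordTime x (n + 1) < j ∧ x (recordTime x (n + 1)) < x j}

/-- The upper record value number `n` (for `n ≥ 1`) of a sequence of random variables. -/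
def recordValue {Ω : Type*} (Y : ℕ → Ω → ℝ) (n : ℕ) (ω : Ω) : ℝ :=
  Y (recordTime (fun i => Y i ω) n) ω

/-- Left extremity `inf {x | F x > 0}` of a distribution function, possibly `-∞`. -/
def leftEnd (F : ℝ → ℝ) : EReal := sInf ((fun x : ℝ => (x : EReal)) '' {x : ℝ | 0 < F x})

/-- Right extremity `sup {x | F x < 1}` of a distribution function, possibly `+∞`. -/
def rightEnd (F : ℝ → ℝ) : EReal := sSup ((fun x : ℝ => (x : EReal)) '' {x : ℝ | F x < 1})

/-- The open interval of all reals strictly between the two extremities. -/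
def openSupport (F : ℝ → ℝ) : Set ℝ := {y : ℝ | leftEnd F < (y : EReal) ∧ (y : EReal) < rightEnd F}

/-- The filter on the real line of one-sided approach `y → a+`, where `a` may be `-∞`. -/
def rightOf (a : EReal) : Filter ℝ := comap (fun x : ℝ => (x : EReal)) (𝓝[>] a)

/-- The filter on the real line of one-sided approach `y → b-`, where `b` may be `+∞`. -/
def leftOf (b : EReal) : Filter ℝ := comap (fun x : ℝ => (x : EReal)) (𝓝[<] b)

/-- The regression function `E[φ(X) | U = u, V = v]`: the integral of `φ` against the regular
conditional law of `X` given `(U, V)`. As usual it is determined up to a null set of pairs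
for the joint law of `(U, V)`. It makes sense whenever `φ` is integrable for the conditional law,
also if `φ(X)` itself is not integrable. -/
def regression {Ω : Type*} [MeasurableSpace Ω] (μ : Measure Ω) [IsFiniteMeasure μ]
    (φ : ℝ → ℝ) (X U V : Ω → ℝ) (u v : ℝ) : ℝ :=
  ∫ x, φ x ∂(condDistrib X (fun ω => (U ω, V ω)) μ (u, v))

end

/-! Let `H = -log (1 - G)` and let `Q` be its right inverse on `(0, ∞)`. As `ν` is the image under
`Q` of the standard exponential law, the hazard measure `ν(dw) / ν(w, ∞)` is the image of Lebesgue
measure (`hazardMeasure_eq_map`). By the Markov property of records (`lintegral_record_succ`), given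
the records `s < t` of numbers `a` and `a + p + 2`, the record number `a + p + 1` has density `(p +
1) (H w - H s) ^ p / (H t - H s) ^ (p + 1)` with respect to the hazard measure
(`map_record_eq_compProd`).

With `k = p + 1`, `T = g ^ (-1 / (k + 1))` and `θ = T ∘ Q`, the regression identity becomes, for `u
< v`, `(p + 1) / (v - u) ^ (p + 1) * ∫ h in u..v, θ h ^ (-(p + 2)) * (h - u) ^ p = θ v ^ (-(p + 1))
* (θ u)⁻¹`. For affine `θ` an explicit antiderivative proves it (`integral_inv_affine_pow`).
Conversely, isolating `((v - u) / θ v) ^ (p + 1)` and differentiating in `v` gives `θ v - (v - u) θ'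
v = θ u`: the tangent at `v` passes through the graph at `u`. Two values of `u` force `θ' v` to be
constant (`exists_affine_of_ae_integral_eq`). So `T = τ + β H`, which is the claimed form of `G`
with `c = 1 / β`.

`G` may be flat on intervals, so `Q` may jump and `θ` is a priori only monotone; the identity also
holds only almost everywhere. Monotonicity together with the identity supplies the missing
regularity. -/

/-! ### Cumulative hazard, its quantile function and the hazard measure -/

section Hazard

open Set

/-- The cumulative hazard function `-log (1 - F)` of a law on the real line. -/
noncomputable def cumHazard (ν : Measure ℝ) (y : ℝ) : ℝ := -Real.log (1 - cdf ν y)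

/-- A right inverse on `(0, ∞)` of the cumulative hazard function of a continuous law. -/
noncomputable def hazardQuantile (ν : Measure ℝ) (h : ℝ) : ℝ :=
  Classical.epsilon fun y => cdf ν y = 1 - Real.exp (-h)

/-- The hazard measure `ν(dw) / ν(w, ∞)`. -/
noncomputable def hazardMeasure (ν : Measure ℝ) : Measure ℝ :=
  ν.withDensity fun w => (ν (Ioi w))⁻¹

variable {ν : Measure ℝ}

lemma measurable_measure_Ioi (ν : Measure ℝ) : Measurable fun w => ν (Ioi w) :=
  Antitone.measurable fun _ _ h => measure_mono (Ioi_subset_Ioi h)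

lemma cumHazard_nonneg (y : ℝ) : 0 ≤ cumHazard ν y := by
  have h0 := cdf_nonneg ν y
  have h1 := cdf_le_one ν y
  exact neg_nonneg.2 (Real.log_nonpos (by linarith) (by linarith))

lemma exp_neg_cumHazard {y : ℝ} (hy : cdf ν y < 1) :
    Real.exp (-cumHazard ν y) = 1 - cdf ν y := by
  rw [cumHazard, neg_neg, Real.exp_log (by linarith)]

lemma measurable_cumHazard (ν : Measure ℝ) : Measurable (cumHazard ν) :=
  (Real.measurable_log.comp (measurable_const.sub (monotone_cdf ν).measurable)).neg

/-- Since `Real.log 0 = 0`, the cumulative hazard takes the default value `0`, not `∞`, where the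
distribution function is `1`. -/
lemma cdf_lt_one_of_cumHazard_pos {y : ℝ} (hy : 0 < cumHazard ν y) : cdf ν y < 1 := by
  refine lt_of_le_of_ne (cdf_le_one ν y) fun h => ?_
  simp [cumHazard, h] at hy

lemma cumHazard_le_of_le {x y : ℝ} (hxy : x ≤ y) (hy : cdf ν y < 1) :
    cumHazard ν x ≤ cumHazard ν y :=
  neg_le_neg (Real.log_le_log (by linarith) (by linarith [monotone_cdf ν hxy]))

lemma lt_of_cumHazard_lt {x y : ℝ} (hx : cdf ν x < 1) (h : cumHazard ν x < cumHazard ν y) :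
    x < y := by
  by_contra! hyx
  exact absurd (cumHazard_le_of_le hyx hx) (not_le.2 h)

lemma cdf_hazardQuantile (hG : Continuous (cdf ν)) {h : ℝ} (hh : 0 < h) :
    cdf ν (hazardQuantile ν h) = 1 - Real.exp (-h) := by
  refine Classical.epsilon_spec (p := fun y => cdf ν y = 1 - Real.exp (-h)) ?_
  have he : Real.exp (-h) < 1 := Real.exp_lt_one_iff.2 (by linarith)
  have hp := Real.exp_pos (-h)
  obtain ⟨a, ha⟩ := ((tendsto_cdf_atBot ν).eventually_lt_const
    (show 0 < 1 - Real.exp (-h) by linarith)).exists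
  obtain ⟨b, hb⟩ := ((tendsto_cdf_atTop ν).eventually_const_lt
    (show 1 - Real.exp (-h) < 1 by linarith)).exists
  obtain ⟨y, hy⟩ := mem_range_of_exists_le_of_exists_ge hG ⟨a, ha.le⟩ ⟨b, hb.le⟩
  exact ⟨y, hy⟩

lemma cumHazard_hazardQuantile (hG : Continuous (cdf ν)) {h : ℝ} (hh : 0 < h) :
    cumHazard ν (hazardQuantile ν h) = h := by
  simp [cumHazard, cdf_hazardQuantile hG hh]

lemma cdf_hazardQuantile_lt_one (hG : Continuous (cdf ν)) {h : ℝ} (hh : 0 < h) :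
    cdf ν (hazardQuantile ν h) < 1 := by
  rw [cdf_hazardQuantile hG hh]; linarith [Real.exp_pos (-h)]

lemma hazardQuantile_lt_of_lt (hG : Continuous (cdf ν)) {h y : ℝ} (hh : 0 < h)
    (hy : h < cumHazard ν y) : hazardQuantile ν h < y :=
  lt_of_cumHazard_lt (cdf_hazardQuantile_lt_one hG hh) (by rwa [cumHazard_hazardQuantile hG hh])

lemma lt_hazardQuantile_of_lt (hG : Continuous (cdf ν)) {h y : ℝ} (hh : 0 < h)
    (h1 : cdf ν y < 1) (hy : cumHazard ν y < h) : y < hazardQuantile ν h :=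
  lt_of_cumHazard_lt h1 (by rwa [cumHazard_hazardQuantile hG hh])

lemma strictMonoOn_hazardQuantile (hG : Continuous (cdf ν)) :
    StrictMonoOn (hazardQuantile ν) (Ioi 0) := fun a ha b hb hab =>
  hazardQuantile_lt_of_lt hG ha (by rwa [cumHazard_hazardQuantile hG hb])

lemma aemeasurable_hazardQuantile (hG : Continuous (cdf ν)) :
    AEMeasurable (hazardQuantile ν) (volume.restrict (Ioi 0)) :=
  aemeasurable_restrict_of_monotoneOn measurableSet_Ioi (strictMonoOn_hazardQuantile hG).monotoneOn

lemma expMeasure_one_eq :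
    expMeasure 1 = (volume.restrict (Ioi 0)).withDensity
      fun h : ℝ => ENNReal.ofReal (Real.exp (-h)) := by
  rw [← withDensity_indicator measurableSet_Ioi]
  change volume.withDensity (exponentialPDF 1) = _
  refine withDensity_congr_ae ?_
  filter_upwards [Measure.ae_ne volume (0 : ℝ)] with x hx
  rcases lt_or_gt_of_ne hx with h | h
  · rw [exponentialPDF_of_neg h, indicator_of_notMem (by simpa using h.le)]
  · rw [exponentialPDF_of_nonneg h.le, indicator_of_mem (mem_Ioi.2 h)]
    simp

lemma aemeasurable_hazardQuantile_expMeasure (hG : Continuous (cdf ν)) :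
    AEMeasurable (hazardQuantile ν) (expMeasure 1) := by
  rw [expMeasure_one_eq]
  exact (aemeasurable_hazardQuantile hG).mono_ac (withDensity_absolutelyContinuous _ _)

lemma ae_expMeasure_pos : ∀ᵐ h ∂(expMeasure 1), 0 < h := by
  rw [expMeasure_one_eq]
  exact (withDensity_absolutelyContinuous _ _).ae_le (ae_restrict_mem measurableSet_Ioi)

instance : IsProbabilityMeasure (expMeasure 1) := isProbabilityMeasure_expMeasure one_pos

instance : NullSingletonClass (expMeasure 1) := by
  rw [expMeasure_one_eq]; infer_instance

lemma map_hazardQuantile_expMeasure [IsProbabilityMeasure ν] (hG : Continuous (cdf ν)) :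
    (expMeasure 1).map (hazardQuantile ν) = ν := by
  have hm := aemeasurable_hazardQuantile_expMeasure hG
  have : IsProbabilityMeasure ((expMeasure 1).map (hazardQuantile ν)) :=
    Measure.isProbabilityMeasure_map hm
  refine Measure.ext_of_Iic _ _ fun y => ?_
  rw [Measure.map_apply_of_aemeasurable hm measurableSet_Iic, ← ofReal_cdf ν]
  rcases (cdf_le_one ν y).lt_or_eq with h1 | h1
  -- The two sets can differ only at `h = H y`: if `G` is flat at that level, the chosen quantile
  -- may lie beyond `y`.
  · have : hazardQuantile ν ⁻¹' Iic y =ᵐ[expMeasure 1] Iic (cumHazard ν y) := by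
      filter_upwards [ae_expMeasure_pos, Measure.ae_ne (expMeasure 1) (cumHazard ν y)] with h hh hne
      refine propext ⟨fun hy => ?_, fun hy => ?_⟩
      · exact (cumHazard_hazardQuantile hG hh).symm.le.trans (cumHazard_le_of_le hy h1)
      · exact (hazardQuantile_lt_of_lt hG hh (lt_of_le_of_ne hy hne)).le
    rw [measure_congr this, ← ofReal_cdf, cdf_expMeasure_eq one_pos, if_pos (cumHazard_nonneg y),
      one_mul, exp_neg_cumHazard h1]
    ring_nf
  · have : hazardQuantile ν ⁻¹' Iic y =ᵐ[expMeasure 1] univ := by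
      filter_upwards [ae_expMeasure_pos] with h hh
      refine propext ⟨fun _ => trivial, fun _ => ?_⟩
      by_contra hc
      have := monotone_cdf ν (not_le.1 hc).le
      linarith [cdf_hazardQuantile_lt_one hG hh]
    rw [measure_congr this, h1]
    simp

lemma measure_Ioi_eq [IsProbabilityMeasure ν] (y : ℝ) :
    ν (Ioi y) = ENNReal.ofReal (1 - cdf ν y) := by
  rw [← compl_Iic, prob_compl_eq_one_sub measurableSet_Iic, ← ofReal_cdf,
    ENNReal.ofReal_sub _ (cdf_nonneg ν y), ENNReal.ofReal_one]

/-- Pulled back by the quantile function, `ν` has density `exp (-h)`, and `ν (Q h, ∞) = exp (-h)`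
cancels it. -/
lemma hazardMeasure_eq_map [IsProbabilityMeasure ν] (hG : Continuous (cdf ν)) :
    hazardMeasure ν = (volume.restrict (Ioi 0)).map (hazardQuantile ν) := by
  have hQ := aemeasurable_hazardQuantile hG
  have hQ' := aemeasurable_hazardQuantile_expMeasure hG
  have hI : Measurable fun w => (ν (Ioi w))⁻¹ := (measurable_measure_Ioi ν).inv
  refine Measure.ext_of_lintegral _ fun f hf => ?_
  rw [lintegral_map' hf.aemeasurable hQ, hazardMeasure,
    lintegral_withDensity_eq_lintegral_mul _ hI hf]
  conv_lhs => rw [← map_hazardQuantile_expMeasure hG]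
  rw [lintegral_map' (by rw [map_hazardQuantile_expMeasure hG]; exact (hI.mul hf).aemeasurable) hQ']
  have hc : AEMeasurable (fun h => (ν (Ioi (hazardQuantile ν h)))⁻¹ * f (hazardQuantile ν h))
      (volume.restrict (Ioi 0)) := (hI.mul hf).comp_aemeasurable hQ
  simp only [Pi.mul_apply]
  rw [map_hazardQuantile_expMeasure hG, expMeasure_one_eq,
    lintegral_withDensity_eq_lintegral_mul₀ (by fun_prop) hc]
  refine setLIntegral_congr_fun measurableSet_Ioi fun h hh => ?_
  have hp : ENNReal.ofReal (Real.exp (-h)) ≠ 0 := by simp [Real.exp_pos]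
  simp only [Pi.mul_apply]
  rw [measure_Ioi_eq, cdf_hazardQuantile hG hh, sub_sub_cancel, ← mul_assoc,
    ENNReal.mul_inv_cancel hp ENNReal.ofReal_ne_top, one_mul]

lemma hazardMeasure_restrict_Ioo [IsProbabilityMeasure ν] (hG : Continuous (cdf ν)) {s y : ℝ}
    (hsy : s < y) (hy : cdf ν y < 1) :
    (hazardMeasure ν).restrict (Ioo s y) =
      (volume.restrict (Ioo (cumHazard ν s) (cumHazard ν y))).map (hazardQuantile ν) := by
  have hQ := aemeasurable_hazardQuantile hG
  have hs : cdf ν s < 1 := (monotone_cdf ν hsy.le).trans_lt hy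
  have hsub : Ioo (cumHazard ν s) (cumHazard ν y) ⊆ Ioi 0 :=
    fun h hh => (cumHazard_nonneg s).trans_lt hh.1
  ext B hB
  rw [Measure.restrict_apply hB, hazardMeasure_eq_map hG,
    Measure.map_apply_of_aemeasurable hQ (hB.inter measurableSet_Ioo),
    Measure.map_apply_of_aemeasurable (hQ.mono_measure (Measure.restrict_mono hsub le_rfl)) hB,
    ← Measure.restrict_restrict_of_subset hsub,
    Measure.restrict_apply₀' (measurableSet_Ioo.nullMeasurableSet)]
  refine measure_congr ?_
  filter_upwards [ae_restrict_mem measurableSet_Ioi, ae_restrict_of_ae (Measure.ae_ne volume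
    (cumHazard ν s)), ae_restrict_of_ae (Measure.ae_ne volume (cumHazard ν y))] with h hh h1 h2
  refine propext ⟨fun hy' => ⟨hy'.1, ?_, ?_⟩, fun hy' => ⟨hy'.1, ?_, ?_⟩⟩
  · refine lt_of_le_of_ne ?_ h1.symm
    have := cumHazard_le_of_le (ν := ν) hy'.2.1.le (cdf_hazardQuantile_lt_one hG hh)
    rwa [cumHazard_hazardQuantile hG hh] at this
  · refine lt_of_le_of_ne ?_ h2
    have := cumHazard_le_of_le (ν := ν) hy'.2.2.le hy
    rwa [cumHazard_hazardQuantile hG hh] at this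
  · exact lt_hazardQuantile_of_lt hG hh hs hy'.2.1
  · exact hazardQuantile_lt_of_lt hG hh hy'.2.2

lemma ae_cdf_mem_Ioo [IsProbabilityMeasure ν] (hG : Continuous (cdf ν)) :
    ∀ᵐ y ∂ν, 0 < cdf ν y ∧ cdf ν y < 1 := by
  have hG' : Measurable (cdf ν) := (monotone_cdf ν).measurable
  rw [← map_hazardQuantile_expMeasure hG]
  rw [ae_map_iff (aemeasurable_hazardQuantile_expMeasure hG)]
  · rw [map_hazardQuantile_expMeasure hG]
    filter_upwards [ae_expMeasure_pos] with h hh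
    refine ⟨?_, cdf_hazardQuantile_lt_one hG hh⟩
    rw [cdf_hazardQuantile hG hh]
    linarith [Real.exp_lt_one_iff.2 (show -h < 0 by linarith)]
  · rw [map_hazardQuantile_expMeasure hG]
    exact (measurableSet_lt measurable_const hG').inter (measurableSet_lt hG' measurable_const)

lemma measure_Iio_eq [IsProbabilityMeasure ν] (hG : Continuous (cdf ν)) (y : ℝ) :
    ν (Iio y) = ENNReal.ofReal (cdf ν y) := by
  have h := StieltjesFunction.measure_Iio (cdf ν) (tendsto_cdf_atBot ν) y
  rw [measure_cdf, hG.continuousAt.continuousWithinAt.leftLim_eq] at h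
  simpa using h

lemma mem_openSupport_cdf_iff (hG : Continuous (cdf ν)) {y : ℝ} :
    y ∈ openSupport (cdf ν) ↔ 0 < cdf ν y ∧ cdf ν y < 1 := by
  constructor
  · rintro ⟨h1, h2⟩
    obtain ⟨_, ⟨a, ha, rfl⟩, hay⟩ := sInf_lt_iff.1 h1
    obtain ⟨_, ⟨b, hb, rfl⟩, hyb⟩ := lt_sSup_iff.1 h2
    exact ⟨lt_of_lt_of_le ha (monotone_cdf ν (EReal.coe_lt_coe_iff.1 hay).le),
      lt_of_le_of_lt (monotone_cdf ν (EReal.coe_lt_coe_iff.1 hyb).le) hb⟩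
  · rintro ⟨h1, h2⟩
    constructor
    · have : ∀ᶠ x in 𝓝[<] y, 0 < cdf ν x :=
        (hG.continuousAt.eventually (lt_mem_nhds h1)).filter_mono nhdsWithin_le_nhds
      obtain ⟨x, hx, hxy⟩ := (this.and self_mem_nhdsWithin).exists
      exact sInf_lt_iff.2 ⟨x, ⟨x, hx, rfl⟩, EReal.coe_lt_coe_iff.2 hxy⟩
    · have : ∀ᶠ x in 𝓝[>] y, cdf ν x < 1 :=
        (hG.continuousAt.eventually (gt_mem_nhds h2)).filter_mono nhdsWithin_le_nhds
      obtain ⟨x, hx, hxy⟩ := (this.and self_mem_nhdsWithin).exists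
      exact lt_sSup_iff.2 ⟨x, ⟨x, hx, rfl⟩, EReal.coe_lt_coe_iff.2 hxy⟩

lemma hazardQuantile_mem_openSupport (hG : Continuous (cdf ν)) {h : ℝ} (hh : 0 < h) :
    hazardQuantile ν h ∈ openSupport (cdf ν) := by
  refine (mem_openSupport_cdf_iff hG).2 ⟨?_, cdf_hazardQuantile_lt_one hG hh⟩
  rw [cdf_hazardQuantile hG hh]
  linarith [Real.exp_lt_one_iff.2 (show -h < 0 by linarith)]

end Hazard

/-! ### Records along a single path -/

section RecordPath

variable {x : ℕ → ℝ}

lemma recordTime_succ (x : ℕ → ℝ) {m : ℕ} (hm : 1 ≤ m) :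
    recordTime x (m + 1) = sInf {j : ℕ | recordTime x m < j ∧ x (recordTime x m) < x j} := by
  obtain ⟨m, rfl⟩ := Nat.exists_eq_add_of_le' hm
  rfl

lemma recordTime_succ_spec (hx : ∀ i, ∃ j, i < j ∧ x i < x j) {m : ℕ} (hm : 1 ≤ m) :
    recordTime x m < recordTime x (m + 1) ∧ x (recordTime x m) < x (recordTime x (m + 1)) := by
  rw [recordTime_succ x hm]
  exact Nat.sInf_mem (hx (recordTime x m))

lemma recordTime_succ_le {m : ℕ} (hm : 1 ≤ m) {j : ℕ} (h1 : recordTime x m < j)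
    (h2 : x (recordTime x m) < x j) : recordTime x (m + 1) ≤ j := by
  rw [recordTime_succ x hm]
  exact Nat.sInf_le ⟨h1, h2⟩

lemma recordTime_le_of_le (hx : ∀ i, ∃ j, i < j ∧ x i < x j) {p q : ℕ} (hp : 1 ≤ p)
    (hpq : p ≤ q) : recordTime x p ≤ recordTime x q := by
  induction q, hpq using Nat.le_induction with
  | base => exact le_rfl
  | succ q hq ih => exact ih.trans (recordTime_succ_spec hx (hp.trans hq)).1.le

/-- The state after the observations `x 0, …, x N`: the number `c` of records so far, the value
of the record number `min c a`, and the current record. -/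
noncomputable def recordState (a : ℕ) (x : ℕ → ℝ) : ℕ → ℕ × ℝ × ℝ
  | 0 => (1, x 0, x 0)
  | N + 1 =>
    if (recordState a x N).2.2 < x (N + 1) then
      ((recordState a x N).1 + 1,
        if (recordState a x N).1 + 1 ≤ a then x (N + 1) else (recordState a x N).2.1, x (N + 1))
    else recordState a x N

lemma recordState_spec (hx : ∀ i, ∃ j, i < j ∧ x i < x j) {a : ℕ} (ha : 1 ≤ a) (N : ℕ) :
    1 ≤ (recordState a x N).1 ∧
    (recordState a x N).2.1 = x (recordTime x (min (recordState a x N).1 a)) ∧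
    (recordState a x N).2.2 = x (recordTime x (recordState a x N).1) ∧
    recordTime x (recordState a x N).1 ≤ N ∧ N < recordTime x ((recordState a x N).1 + 1) := by
  induction N with
  | zero =>
    refine ⟨le_rfl, ?_, rfl, le_rfl, ?_⟩
    · simp only [recordState, min_eq_left ha]; rfl
    · exact (Nat.zero_le _).trans_lt (recordTime_succ_spec hx le_rfl).1
  | succ N ih =>
    obtain ⟨h1, h2, h3, h4, h5⟩ := ih
    by_cases h : (recordState a x N).2.2 < x (N + 1)
    · have ht : recordTime x ((recordState a x N).1 + 1) = N + 1 :=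
        le_antisymm (recordTime_succ_le h1 (by omega) (h3 ▸ h)) h5
      simp only [recordState, if_pos h]
      refine ⟨by omega, ?_, by rw [ht], ht.le, ?_⟩
      · split_ifs with hc
        · rw [min_eq_left hc, ht]
        · rw [h2, min_eq_right (by omega), min_eq_right (by omega)]
      · have := (recordTime_succ_spec hx (show 1 ≤ (recordState a x N).1 + 1 by omega)).1
        omega
    · simp only [recordState, if_neg h]
      refine ⟨h1, h2, h3, by omega, lt_of_le_of_ne h5 fun he => h ?_⟩
      have := (recordTime_succ_spec hx h1).2
      rwa [← he, ← h3] at this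

/-- Whether record number `m + 1` occurs at time `N + 1` is thus decided by the past state and one
new observation, which is the form that independence can use. -/
lemma recordState_eq_iff (hx : ∀ i, ∃ j, i < j ∧ x i < x j) {a m : ℕ} (ha : 1 ≤ a) (hm : 1 ≤ m)
    (N : ℕ) : ((recordState a x N).1 = m ∧ (recordState a x N).2.2 < x (N + 1)) ↔
      N + 1 = recordTime x (m + 1) := by
  obtain ⟨h1, -, h3, h4, h5⟩ := recordState_spec hx ha N
  constructor
  · rintro ⟨rfl, h⟩
    exact (le_antisymm (recordTime_succ_le h1 (by omega) (h3 ▸ h)) h5).symm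
  · intro h
    have hle : m ≤ (recordState a x N).1 := by
      by_contra! hc
      have := recordTime_le_of_le hx (show 1 ≤ (recordState a x N).1 + 1 by omega)
        (show (recordState a x N).1 + 1 ≤ m by omega)
      have := (recordTime_succ_spec hx hm).1
      omega
    have hge : (recordState a x N).1 ≤ m := by
      by_contra! hc
      have := recordTime_le_of_le hx (show 1 ≤ m + 1 by omega)
        (show m + 1 ≤ (recordState a x N).1 by omega)
      omega
    have he := le_antisymm hge hle
    refine ⟨he, ?_⟩
    rw [h3, he, h]
    exact (recordTime_succ_spec hx hm).2

end RecordPath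

/-! ### Markov property of the record sequence -/

section RecordMarkov

open Set

variable {Ω : Type*} [MeasurableSpace Ω] {μ : Measure Ω} [IsProbabilityMeasure μ]
  {Y : ℕ → Ω → ℝ} {ν : Measure ℝ}

lemma measurable_nat_sInf {α : Type*} [MeasurableSpace α] {p : α → ℕ → Prop}
    (hp : ∀ N, MeasurableSet {x | p x N}) : Measurable fun x => sInf {N | p x N} := by
  refine measurable_of_Ioi fun k => ?_
  -- Nonemptiness must be required separately, because `sInf ∅ = 0`.
  have : (fun x => sInf {N | p x N}) ⁻¹' Ioi k =
      (⋃ N, {x | p x N}) ∩ ⋂ j ∈ Iic k, {x | p x j}ᶜ := by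
    ext x
    simp only [mem_preimage, mem_Ioi, mem_inter_iff, mem_iUnion, mem_iInter, mem_Iic,
      mem_compl_iff, mem_ofPred_eq]
    constructor
    · intro h
      have hne : {N | p x N}.Nonempty := by
        by_contra hc
        rw [not_nonempty_iff_eq_empty.1 hc, Nat.sInf_empty] at h
        omega
      exact ⟨hne, fun j hj hpj => absurd (Nat.sInf_le (s := {N | p x N}) hpj) (by omega)⟩
    · rintro ⟨hne, h⟩
      by_contra hc
      exact h _ (not_lt.1 hc) (Nat.sInf_mem (s := {N | p x N}) hne)
  rw [this]
  exact (MeasurableSet.iUnion hp).inter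
    (MeasurableSet.biInter (to_countable _) fun j _ => (hp j).compl)

lemma measurable_recordTime (hmeas : ∀ i, Measurable (Y i)) (m : ℕ) :
    Measurable fun ω => recordTime (fun i => Y i ω) m := by
  induction m with
  | zero => exact measurable_const
  | succ m ih =>
    rcases Nat.eq_zero_or_pos m with rfl | hm
    · exact measurable_const
    · have hval : Measurable fun ω => Y (recordTime (fun i => Y i ω) m) ω :=
        (measurable_from_prod_countable_right (f := fun p : ℕ × Ω => Y p.1 p.2) hmeas).comp
          (ih.prodMk measurable_id)
      simp only [recordTime_succ _ hm]
      exact measurable_nat_sInf fun j => (measurableSet_lt ih measurable_const).inter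
        (measurableSet_lt hval (hmeas j))

lemma measurable_recordValue (hmeas : ∀ i, Measurable (Y i)) (m : ℕ) :
    Measurable (recordValue Y m) :=
  (measurable_from_prod_countable_right (f := fun p : ℕ × Ω => Y p.1 p.2) hmeas).comp
    ((measurable_recordTime hmeas m).prodMk measurable_id)

lemma measurable_recordState_natural (hY : ∀ i, StronglyMeasurable (Y i)) (a N : ℕ) :
    Measurable[Filtration.natural Y hY N] fun ω => recordState a (fun i => Y i ω) N := by
  induction N with
  | zero =>
    have h0 : Measurable[Filtration.natural Y hY 0] (Y 0) :=
      ((Filtration.stronglyAdapted_natural hY) 0).measurable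
    exact measurable_const.prodMk (h0.prodMk h0)
  | succ N ih =>
    have hs : Measurable[Filtration.natural Y hY (N + 1)]
        fun ω => recordState a (fun i => Y i ω) N :=
      ih.mono ((Filtration.natural Y hY).mono N.le_succ) le_rfl
    have hy : Measurable[Filtration.natural Y hY (N + 1)] (Y (N + 1)) :=
      ((Filtration.stronglyAdapted_natural hY) (N + 1)).measurable
    simp only [recordState]
    refine Measurable.ite (measurableSet_lt hs.snd.snd hy) ?_ hs
    refine (hs.fst.add_const 1).prodMk (Measurable.prodMk ?_ hy)
    exact Measurable.ite (measurableSet_le (hs.fst.add_const 1) measurable_const) hy hs.snd.fst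

lemma map_recordState_prodMk (hmeas : ∀ i, Measurable (Y i)) (hind : iIndepFun Y μ)
    (hlaw : ∀ i, μ.map (Y i) = ν) (a N : ℕ) :
    μ.map (fun ω => (recordState a (fun i => Y i ω) N, Y (N + 1) ω)) =
      (μ.map fun ω => recordState a (fun i => Y i ω) N).prod ν := by
  have hY : ∀ i, StronglyMeasurable (Y i) := fun i => (hmeas i).stronglyMeasurable
  have hs := measurable_recordState_natural hY a N
  have hs' : Measurable fun ω => recordState a (fun i => Y i ω) N :=
    hs.mono ((Filtration.natural Y hY).le N) le_rfl
  have hi : IndepFun (fun ω => recordState a (fun i => Y i ω) N) (Y (N + 1)) μ := by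
    rw [IndepFun_iff_Indep]
    exact (indep_of_indep_of_le_right (hind.indep_comap_natural_of_lt hY N.lt_succ_self)
      hs.comap_le).symm
  rw [(indepFun_iff_map_prod_eq_prod_map_map hs'.aemeasurable (hmeas _).aemeasurable).1 hi, hlaw]

variable [IsProbabilityMeasure ν]

/-- By the second Borel–Cantelli lemma every rational `q` with `G q < 1` is exceeded infinitely
often. Almost surely `G (Y i) < 1`, and continuity of `G` leaves room for such a `q` above `Y i`. -/
lemma ae_exists_lt_of_iIndepFun (hmeas : ∀ i, Measurable (Y i)) (hind : iIndepFun Y μ)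
    (hlaw : ∀ i, μ.map (Y i) = ν) (hG : Continuous (cdf ν)) :
    ∀ᵐ ω ∂μ, ∀ i, ∃ j, i < j ∧ Y i ω < Y j ω := by
  have hq : ∀ᵐ ω ∂μ, ∀ q : ℚ, cdf ν q < 1 → ∃ᶠ j in atTop, (q : ℝ) < Y j ω := by
    rw [ae_all_iff]
    intro q
    by_cases hq : cdf ν q < 1
    · have hset : ∀ j, MeasurableSet (Y j ⁻¹' Ioi (q : ℝ)) := fun j => hmeas j measurableSet_Ioi
      have hi : iIndepSet (fun j => Y j ⁻¹' Ioi (q : ℝ)) μ :=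
        (iIndepSet_iff_meas_biInter hset).2 fun t =>
          hind.measure_inter_preimage_eq_mul t fun _ _ => measurableSet_Ioi
      have hsum : ∑' j, μ (Y j ⁻¹' Ioi (q : ℝ)) = ⊤ := by
        have : ∀ j, μ (Y j ⁻¹' Ioi (q : ℝ)) = ν (Ioi (q : ℝ)) := fun j => by
          rw [← hlaw j, Measure.map_apply (hmeas j) measurableSet_Ioi]
        simp only [this]
        refine ENNReal.tsum_const_eq_top_of_ne_zero ?_
        rw [measure_Ioi_eq]
        simpa using hq
      have h1 := measure_limsup_eq_one hset hi hsum
      have h2 : ∀ᵐ ω ∂μ, ω ∈ limsup (fun j => Y j ⁻¹' Ioi (q : ℝ)) atTop :=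
        (prob_compl_eq_zero_iff (MeasurableSet.measurableSet_limsup hset)).2 h1
      filter_upwards [h2] with ω hω _
      exact mem_limsup_iff_frequently_mem.1 hω
    · exact ae_of_all _ fun _ h => absurd h hq
  have hlt : ∀ᵐ ω ∂μ, ∀ i, cdf ν (Y i ω) < 1 := by
    rw [ae_all_iff]
    intro i
    have := ae_cdf_mem_Ioo hG
    rw [← hlaw i] at this
    filter_upwards [ae_of_ae_map (hmeas i).aemeasurable this] with ω hω
    rw [hlaw i] at hω
    exact hω.2
  filter_upwards [hq, hlt] with ω h1 h2 i
  have : ∀ᶠ y in 𝓝[>] (Y i ω), cdf ν y < 1 :=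
    (hG.continuousAt.eventually_lt_const (h2 i)).filter_mono nhdsWithin_le_nhds
  obtain ⟨y, hy, hiy : Y i ω < y⟩ := (this.and self_mem_nhdsWithin).exists
  obtain ⟨q, hq1, hq2⟩ := exists_rat_btwn hiy
  obtain ⟨j, hj, hij⟩ := ((h1 q ((monotone_cdf ν hq2.le).trans_lt hy)).and_eventually
    (eventually_gt_atTop i)).exists
  exact ⟨j, hij, hq1.trans hj⟩

/-- The transition operator of the sequence of record values: the mean of `F u w` under the law
`ν` conditioned to `(w, ∞)`. -/
noncomputable def recordStep (ν : Measure ℝ) (F : ℝ → ℝ → ℝ → ENNReal) (u w : ℝ) : ENNReal :=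
  (ν (Ioi w))⁻¹ * ∫⁻ y in Ioi w, F u w y ∂ν

/-- Split according to the time `N + 1` of record number `m + 1`; on almost every path exactly one
`N` contributes. The new observation is independent of the state and is integrated out. -/
lemma lintegral_record_eq_tsum (hmeas : ∀ i, Measurable (Y i)) (hind : iIndepFun Y μ)
    (hlaw : ∀ i, μ.map (Y i) = ν) (hG : Continuous (cdf ν)) {a m : ℕ} (ha : 1 ≤ a) (ham : a ≤ m)
    {F : ℝ → ℝ → ℝ → ENNReal} (hF : Measurable fun p : ℝ × ℝ × ℝ => F p.1 p.2.1 p.2.2) :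
    ∫⁻ ω, F (recordValue Y a ω) (recordValue Y m ω) (recordValue Y (m + 1) ω) ∂μ =
      ∑' N, ∫⁻ s : ℕ × ℝ × ℝ, (if s.1 = m then ∫⁻ y in Ioi s.2.2, F s.2.1 s.2.2 y ∂ν else 0)
        ∂(μ.map fun ω => recordState a (fun i => Y i ω) N) := by
  have hm : 1 ≤ m := ha.trans ham
  let Φ : (ℕ × ℝ × ℝ) × ℝ → ENNReal := fun p =>
    if p.1.1 = m ∧ p.1.2.2 < p.2 then F p.1.2.1 p.1.2.2 p.2 else 0
  have hΦ : Measurable Φ := by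
    refine Measurable.ite ?_ ?_ measurable_const
    · exact (measurableSet_eq_fun measurable_fst.fst measurable_const).inter
        (measurableSet_lt measurable_fst.snd.snd measurable_snd)
    · exact hF.comp (f := fun p : (ℕ × ℝ × ℝ) × ℝ => (p.1.2.1, p.1.2.2, p.2)) (by fun_prop)
  have hs : ∀ N, Measurable fun ω => recordState a (fun i => Y i ω) N := fun N =>
    (measurable_recordState_natural (fun i => (hmeas i).stronglyMeasurable) a N).mono
      (Filtration.le _ N) le_rfl
  have h1 : ∫⁻ ω, F (recordValue Y a ω) (recordValue Y m ω) (recordValue Y (m + 1) ω) ∂μ =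
      ∫⁻ ω, ∑' N, Φ (recordState a (fun i => Y i ω) N, Y (N + 1) ω) ∂μ := by
    refine lintegral_congr_ae ?_
    filter_upwards [ae_exists_lt_of_iIndepFun hmeas hind hlaw hG] with ω hω
    have hpos : 0 < recordTime (fun i => Y i ω) (m + 1) :=
      (Nat.zero_le _).trans_lt (recordTime_succ_spec hω hm).1
    obtain ⟨N, hN⟩ := Nat.exists_eq_add_of_le' hpos
    rw [tsum_eq_single N]
    · have hst := (recordState_eq_iff hω ha hm N).2 hN.symm
      obtain ⟨-, h2, h3, -⟩ := recordState_spec hω ha N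
      simp only [Φ, if_pos hst, h2, h3, hst.1, min_eq_right ham, recordValue, hN]
    · intro N' hN'
      refine if_neg fun h => hN' ?_
      have := (recordState_eq_iff hω ha hm N').1 h
      omega
  rw [h1, lintegral_tsum fun N => Measurable.aemeasurable
    (f := fun ω => Φ (recordState a (fun i => Y i ω) N, Y (N + 1) ω))
    (hΦ.comp ((hs N).prodMk (hmeas _)))]
  refine tsum_congr fun N => ?_
  rw [← lintegral_map hΦ ((hs N).prodMk (hmeas _)), map_recordState_prodMk hmeas hind hlaw,
    lintegral_prod _ hΦ.aemeasurable]
  refine lintegral_congr fun s => ?_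
  by_cases h : s.1 = m
  · rw [if_pos h, ← lintegral_indicator measurableSet_Ioi]
    refine lintegral_congr fun y => ?_
    simp only [Φ, h, true_and, indicator, mem_Ioi]
  · simp [Φ, h]

lemma measurable_lintegral_Ioi {α : Type*} [MeasurableSpace α] (ρ : Measure ℝ) [SFinite ρ]
    {f : α → ℝ → ENNReal} (hf : Measurable fun p : α × ℝ => f p.1 p.2) {l : α → ℝ}
    (hl : Measurable l) : Measurable fun p => ∫⁻ y in Ioi (l p), f p y ∂ρ := by
  simp only [← lintegral_indicator measurableSet_Ioi]
  refine Measurable.lintegral_prod_right' (f := fun p : α × ℝ => (Ioi (l p.1)).indicator (f p.1) p.2) ?_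
  have : (fun p : α × ℝ => (Ioi (l p.1)).indicator (f p.1) p.2) =
      {p : α × ℝ | l p.1 < p.2}.indicator fun p => f p.1 p.2 := by
    ext p; simp only [indicator, mem_Ioi, mem_ofPred_eq]
  rw [this]
  exact hf.indicator (measurableSet_lt (hl.comp measurable_fst) measurable_snd)

lemma measurable_recordStep {F : ℝ → ℝ → ℝ → ENNReal}
    (hF : Measurable fun p : ℝ × ℝ × ℝ => F p.1 p.2.1 p.2.2) :
    Measurable fun p : ℝ × ℝ => recordStep ν F p.1 p.2 :=
  ((measurable_measure_Ioi ν).comp measurable_snd).inv.mul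
    (measurable_lintegral_Ioi ν (f := fun (p : ℝ × ℝ) y => F p.1 p.2 y)
      (hF.comp (f := fun q : (ℝ × ℝ) × ℝ => (q.1.1, q.1.2, q.2)) (by fun_prop)) measurable_snd)

/-- The Markov property of record values. -/
theorem lintegral_record_succ (hmeas : ∀ i, Measurable (Y i)) (hind : iIndepFun Y μ)
    (hlaw : ∀ i, μ.map (Y i) = ν) (hG : Continuous (cdf ν)) {a m : ℕ} (ha : 1 ≤ a) (ham : a ≤ m)
    {F : ℝ → ℝ → ℝ → ENNReal} (hF : Measurable fun p : ℝ × ℝ × ℝ => F p.1 p.2.1 p.2.2) :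
    ∫⁻ ω, F (recordValue Y a ω) (recordValue Y m ω) (recordValue Y (m + 1) ω) ∂μ =
      ∫⁻ ω, recordStep ν F (recordValue Y a ω) (recordValue Y m ω) ∂μ := by
  rw [lintegral_record_eq_tsum hmeas hind hlaw hG ha ham hF,
    -- The same expansion, applied to an integrand that ignores the new record, gives each term a
    -- factor `ν (w, ∞)` that cancels the normalization of `recordStep`. No law of record times is
    -- needed.
    lintegral_record_eq_tsum hmeas hind hlaw hG ha ham (F := fun u w _ => recordStep ν F u w)
      ((measurable_recordStep hF).comp
        (f := fun p : ℝ × ℝ × ℝ => (p.1, p.2.1)) (by fun_prop))]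
  refine tsum_congr fun N => lintegral_congr fun s => ?_
  congr 1
  rw [lintegral_const, Measure.restrict_apply_univ, recordStep, mul_comm, ← mul_assoc]
  by_cases h : ν (Ioi s.2.2) = 0
  · rw [Measure.restrict_eq_zero.2 h]; simp
  · rw [ENNReal.mul_inv_cancel h (measure_ne_top _ _), one_mul]

end RecordMarkov

/-! ### Joint laws of two and three records -/

section RecordLaw

open Set

variable {ν : Measure ℝ}

/-- The density `(H y - H s) ^ p / p!`, with `H` the cumulative hazard function. -/
noncomputable def hazardPow (ν : Measure ℝ) (p : ℕ) (s y : ℝ) : ENNReal :=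
  ENNReal.ofReal ((cumHazard ν y - cumHazard ν s) ^ p / p.factorial)

lemma measurable_hazardPow (p : ℕ) : Measurable fun q : ℝ × ℝ => hazardPow ν p q.1 q.2 := by
  have := measurable_cumHazard ν
  unfold hazardPow
  fun_prop

lemma measurable_hazardPow_right (p : ℕ) (s : ℝ) : Measurable fun y => hazardPow ν p s y := by
  have := measurable_cumHazard ν
  unfold hazardPow
  fun_prop

@[simp] lemma hazardPow_zero (s y : ℝ) : hazardPow ν 0 s y = 1 := by simp [hazardPow]

lemma setLIntegral_hazardMeasure {A : Set ℝ} (hA : MeasurableSet A) {f : ℝ → ENNReal}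
    (hf : Measurable f) :
    ∫⁻ w in A, f w ∂hazardMeasure ν = ∫⁻ w in A, (ν (Ioi w))⁻¹ * f w ∂ν := by
  have hI : Measurable fun w => (ν (Ioi w))⁻¹ := (measurable_measure_Ioi ν).inv
  rw [hazardMeasure, setLIntegral_withDensity_eq_setLIntegral_mul _ hI hf hA]
  rfl

variable [IsProbabilityMeasure ν]

instance : SFinite (hazardMeasure ν) := by unfold hazardMeasure; infer_instance

lemma lintegral_hazardMeasure_Ioo (hG : Continuous (cdf ν)) {s y : ℝ} (hsy : s < y)
    (hy : cdf ν y < 1) {f : ℝ → ENNReal} (hf : Measurable f) :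
    ∫⁻ w in Ioo s y, f w ∂hazardMeasure ν =
      ∫⁻ h in Ioo (cumHazard ν s) (cumHazard ν y), f (hazardQuantile ν h) := by
  have hsub : Ioo (cumHazard ν s) (cumHazard ν y) ⊆ Ioi 0 :=
    fun h hh => (cumHazard_nonneg s).trans_lt hh.1
  rw [hazardMeasure_restrict_Ioo hG hsy hy, lintegral_map' hf.aemeasurable
    ((aemeasurable_hazardQuantile hG).mono_measure (Measure.restrict_mono hsub le_rfl))]

lemma lintegral_hazardPow (hG : Continuous (cdf ν)) (p : ℕ) {s y : ℝ} (hsy : s < y)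
    (hy : cdf ν y < 1) :
    ∫⁻ w in Ioo s y, hazardPow ν p s w ∂hazardMeasure ν = hazardPow ν (p + 1) s y := by
  have hle := cumHazard_le_of_le hsy.le hy
  rw [lintegral_hazardMeasure_Ioo hG hsy hy (measurable_hazardPow_right p s)]
  have h1 : ∫⁻ h in Ioo (cumHazard ν s) (cumHazard ν y), hazardPow ν p s (hazardQuantile ν h) =
      ∫⁻ h in Ioo (cumHazard ν s) (cumHazard ν y),
        ENNReal.ofReal ((h - cumHazard ν s) ^ p / p.factorial) := by
    refine setLIntegral_congr_fun measurableSet_Ioo fun h hh => ?_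
    simp only [hazardPow]
    rw [cumHazard_hazardQuantile hG ((cumHazard_nonneg s).trans_lt hh.1)]
  rw [h1, ← ofReal_integral_eq_lintegral_ofReal, ← integral_Ioc_eq_integral_Ioo,
    ← intervalIntegral.integral_of_le hle, hazardPow]
  · rw [intervalIntegral.integral_div, intervalIntegral.integral_comp_sub_right (fun x => x ^ p),
      integral_pow, Nat.factorial_succ]
    congr 1
    push_cast
    field_simp
    simp
  · refine Integrable.mono_measure (ν := volume.restrict (Icc (cumHazard ν s) (cumHazard ν y))) ?_
      (Measure.restrict_mono Ioo_subset_Icc_self le_rfl)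
    exact Continuous.integrableOn_Icc (by fun_prop)
  · filter_upwards [ae_restrict_mem measurableSet_Ioo] with h hh
    have : 0 ≤ h - cumHazard ν s := by linarith [hh.1]
    positivity

variable {Ω : Type*} [MeasurableSpace Ω] {μ : Measure Ω} [IsProbabilityMeasure μ]
  {Y : ℕ → Ω → ℝ}

/-- The joint law of the record values number `a` and `a + p + 1`. -/
def RecordPairLaw (μ : Measure Ω) (Y : ℕ → Ω → ℝ) (ν : Measure ℝ) (a p : ℕ) : Prop :=
  ∀ F : ℝ → ℝ → ENNReal, Measurable (fun q : ℝ × ℝ => F q.1 q.2) →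
    ∫⁻ ω, F (recordValue Y a ω) (recordValue Y (a + p + 1) ω) ∂μ =
      ∫⁻ ω, (ν (Ioi (recordValue Y a ω)))⁻¹ * ∫⁻ y in Ioi (recordValue Y a ω),
        hazardPow ν p (recordValue Y a ω) y * F (recordValue Y a ω) y ∂ν ∂μ

lemma lintegral_Ioi_Ioi_swap {f : ℝ → ℝ → ENNReal} (hf : Measurable fun q : ℝ × ℝ => f q.1 q.2)
    (s : ℝ) :
    ∫⁻ w in Ioi s, ∫⁻ y in Ioi w, f w y ∂ν ∂hazardMeasure ν =
      ∫⁻ y in Ioi s, ∫⁻ w in Ioo s y, f w y ∂hazardMeasure ν ∂ν := by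
  have hm : Measurable fun q : ℝ × ℝ => if s < q.1 ∧ q.1 < q.2 then f q.1 q.2 else 0 :=
    Measurable.ite ((measurableSet_lt measurable_const measurable_fst).inter
      (measurableSet_lt measurable_fst measurable_snd)) hf measurable_const
  have h1 : ∫⁻ w in Ioi s, ∫⁻ y in Ioi w, f w y ∂ν ∂hazardMeasure ν =
      ∫⁻ w, ∫⁻ y, (if s < w ∧ w < y then f w y else 0) ∂ν ∂hazardMeasure ν := by
    rw [← lintegral_indicator measurableSet_Ioi]
    refine lintegral_congr fun w => ?_
    by_cases hw : s < w
    · rw [indicator_of_mem (mem_Ioi.2 hw), ← lintegral_indicator measurableSet_Ioi]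
      simp only [hw, true_and, indicator, mem_Ioi]
    · rw [indicator_of_notMem (by simpa using hw)]
      simp [hw]
  have h2 : ∫⁻ y in Ioi s, ∫⁻ w in Ioo s y, f w y ∂hazardMeasure ν ∂ν =
      ∫⁻ y, ∫⁻ w, (if s < w ∧ w < y then f w y else 0) ∂hazardMeasure ν ∂ν := by
    rw [← lintegral_indicator measurableSet_Ioi]
    refine lintegral_congr fun y => ?_
    by_cases hy : s < y
    · rw [indicator_of_mem (mem_Ioi.2 hy), ← lintegral_indicator measurableSet_Ioo]
      simp only [indicator, mem_Ioo]
    · rw [indicator_of_notMem (by simpa using hy)]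
      have : ∀ w, ¬ (s < w ∧ w < y) := fun w hw => hy (hw.1.trans hw.2)
      simp [this]
  rw [h1, h2, lintegral_lintegral_swap hm.aemeasurable]

/-- The factor `1 / ν (w, ∞)` of the Markov step turns `ν(dw)` into the hazard measure; Tonelli then
puts the integral over the intermediate record inside. -/
lemma RecordPairLaw.lintegral_triple (hmeas : ∀ i, Measurable (Y i)) (hind : iIndepFun Y μ)
    (hlaw : ∀ i, μ.map (Y i) = ν) (hG : Continuous (cdf ν)) {a p : ℕ} (ha : 1 ≤ a)
    (h : RecordPairLaw μ Y ν a p) {F : ℝ → ℝ → ℝ → ENNReal}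
    (hF : Measurable fun p : ℝ × ℝ × ℝ => F p.1 p.2.1 p.2.2) :
    ∫⁻ ω, F (recordValue Y a ω) (recordValue Y (a + p + 1) ω) (recordValue Y (a + p + 2) ω) ∂μ =
      ∫⁻ ω, (ν (Ioi (recordValue Y a ω)))⁻¹ * ∫⁻ y in Ioi (recordValue Y a ω),
        ∫⁻ w in Ioo (recordValue Y a ω) y, hazardPow ν p (recordValue Y a ω) w *
          F (recordValue Y a ω) w y ∂hazardMeasure ν ∂ν ∂μ := by
  rw [lintegral_record_succ hmeas hind hlaw hG ha (by omega : a ≤ a + p + 1) hF,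
    h _ (measurable_recordStep hF)]
  refine lintegral_congr fun ω => ?_
  congr 1
  generalize recordValue Y a ω = s
  have hp := measurable_hazardPow_right (ν := ν) p s
  have hFs : Measurable fun q : ℝ × ℝ => F s q.1 q.2 :=
    hF.comp (f := fun q : ℝ × ℝ => (s, q.1, q.2)) (by fun_prop)
  have hf : Measurable fun q : ℝ × ℝ => hazardPow ν p s q.1 * F s q.1 q.2 :=
    (hp.comp measurable_fst).mul hFs
  have hm : Measurable fun w => ∫⁻ y in Ioi w, hazardPow ν p s w * F s w y ∂ν :=
    measurable_lintegral_Ioi ν hf measurable_id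
  rw [← lintegral_Ioi_Ioi_swap hf, setLIntegral_hazardMeasure measurableSet_Ioi hm]
  refine setLIntegral_congr_fun measurableSet_Ioi fun w _ => ?_
  simp only [recordStep]
  have hFw : Measurable fun y => F s w y := hFs.comp measurable_prodMk_left
  rw [lintegral_const_mul _ hFw]
  ring

theorem recordPairLaw (hmeas : ∀ i, Measurable (Y i)) (hind : iIndepFun Y μ)
    (hlaw : ∀ i, μ.map (Y i) = ν) (hG : Continuous (cdf ν)) {a : ℕ} (ha : 1 ≤ a) (p : ℕ) :
    RecordPairLaw μ Y ν a p := by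
  induction p with
  | zero =>
    intro F hF
    have h := lintegral_record_succ hmeas hind hlaw hG ha le_rfl (F := fun u _ y => F u y)
      (hF.comp (f := fun p : ℝ × ℝ × ℝ => (p.1, p.2.2)) (by fun_prop))
    simpa [recordStep] using h
  | succ p ih =>
    intro F hF
    have h := ih.lintegral_triple hmeas hind hlaw hG ha (F := fun u _ y => F u y)
      (hF.comp (f := fun p : ℝ × ℝ × ℝ => (p.1, p.2.2)) (by fun_prop))
    refine h.trans (lintegral_congr fun ω => ?_)
    congr 1
    generalize recordValue Y a ω = s
    refine setLIntegral_congr_fun_ae measurableSet_Ioi ?_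
    filter_upwards [ae_cdf_mem_Ioo hG] with y hy hsy
    rw [lintegral_mul_const _ (measurable_hazardPow_right p s), lintegral_hazardPow hG p hsy hy.2]

/-- If `B` is null for record number `a + 1`, then `ν (B ∩ (s, ∞)) = 0` for `ν`-almost every `s`. By
Tonelli `ν (-∞, y)` integrates to `0` over `B`, but it equals `G y`, which is positive almost
everywhere. -/
lemma absolutelyContinuous_map_recordValue (hmeas : ∀ i, Measurable (Y i)) (hind : iIndepFun Y μ)
    (hlaw : ∀ i, μ.map (Y i) = ν) (hG : Continuous (cdf ν)) {a : ℕ} (ha : 1 ≤ a) :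
    ν ≪ μ.map (recordValue Y a) := by
  induction a, ha using Nat.le_induction with
  | base =>
    have : recordValue Y 1 = Y 0 := rfl
    rw [this, hlaw]
  | succ a ha ih =>
    refine Measure.AbsolutelyContinuous.mk fun B hB h0 => ?_
    have h := recordPairLaw hmeas hind hlaw hG ha 0 (fun _ y => B.indicator 1 y)
      ((measurable_one.indicator hB).comp measurable_snd)
    have hR := measurable_recordValue hmeas (a + 1)
    have hm : Measurable fun s => (ν (Ioi s))⁻¹ * ∫⁻ y in Ioi s, B.indicator 1 y ∂ν :=
      (measurable_measure_Ioi ν).inv.mul (measurable_lintegral_Ioi ν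
        (f := fun _ y => B.indicator 1 y) ((measurable_one.indicator hB).comp measurable_snd)
        measurable_id)
    simp only [hazardPow_zero, one_mul, add_zero] at h
    rw [← lintegral_map (f := B.indicator 1) (measurable_one.indicator hB) hR,
      lintegral_indicator_one hB, h0, ← lintegral_map (f := fun s => (ν (Ioi s))⁻¹ *
        ∫⁻ y in Ioi s, B.indicator 1 y ∂ν) hm (measurable_recordValue hmeas a), eq_comm,
      lintegral_eq_zero_iff hm] at h
    have h1 : ∀ᵐ s ∂ν, ∫⁻ y in Ioi s, B.indicator 1 y ∂ν = 0 := by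
      filter_upwards [ih.ae_le h] with s hs
      rcases mul_eq_zero.1 hs with hs | hs
      · exact absurd hs (by simp)
      · exact hs
    have h2 : ∫⁻ y in B, ν (Iio y) ∂ν = 0 := by
      have hmm : Measurable fun q : ℝ × ℝ => if q.1 < q.2 then B.indicator (1 : ℝ → ENNReal) q.2 else 0 :=
        Measurable.ite (measurableSet_lt measurable_fst measurable_snd)
          ((measurable_one.indicator hB).comp measurable_snd) measurable_const
      have h3 : ∫⁻ s, ∫⁻ y, (if s < y then B.indicator (1 : ℝ → ENNReal) y else 0) ∂ν ∂ν = 0 := by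
        rw [lintegral_congr_ae (g := 0), lintegral_zero_fun]
        filter_upwards [h1] with s hs
        rw [← lintegral_indicator measurableSet_Ioi] at hs
        rw [Pi.zero_apply]
        refine (lintegral_congr fun y => ?_).trans hs
        simp only [indicator, mem_Ioi]
      rw [lintegral_lintegral_swap hmm.aemeasurable] at h3
      rw [← lintegral_indicator hB, ← h3]
      refine lintegral_congr fun y => ?_
      by_cases hy : y ∈ B
      · rw [indicator_of_mem hy, ← lintegral_indicator_one measurableSet_Iio]
        simp [hy, indicator]
      · simp [hy]
    rw [lintegral_eq_zero_iff] at h2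
    · have h4 : ∀ᵐ y ∂ν.restrict B, False := by
        filter_upwards [h2, ae_restrict_of_ae (ae_cdf_mem_Ioo hG)] with y h5 h6
        rw [measure_Iio_eq hG] at h5
        simp only [Pi.zero_apply, ENNReal.ofReal_eq_zero] at h5
        linarith
      simpa using h4
    · exact Monotone.measurable fun _ _ h => measure_mono (Iio_subset_Iio h)

end RecordLaw

/-! ### Conditional law of a record given an earlier and the next record -/

section RecordKernel

open Set

variable {ν : Measure ℝ}

/-- The conditional density, with respect to the hazard measure, of the record value number
`a + p + 1` given those of number `a` and `a + p + 2`. -/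
noncomputable def recordCondDensity (ν : Measure ℝ) (p : ℕ) (q : ℝ × ℝ) (w : ℝ) : ENNReal :=
  if (q.1 < q.2 ∧ cumHazard ν q.1 < cumHazard ν q.2) ∧ w ∈ Ioo q.1 q.2 then
    (hazardPow ν (p + 1) q.1 q.2)⁻¹ * hazardPow ν p q.1 w else 0

lemma measurable_recordCondDensity (p : ℕ) :
    Measurable fun r : (ℝ × ℝ) × ℝ => recordCondDensity ν p r.1 r.2 := by
  have hH := measurable_cumHazard ν
  refine Measurable.ite ?_ ?_ measurable_const
  · refine ((measurableSet_lt measurable_fst.fst measurable_fst.snd).inter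
      (measurableSet_lt (hH.comp measurable_fst.fst) (hH.comp measurable_fst.snd))).inter ?_
    exact (measurableSet_lt measurable_fst.fst measurable_snd).inter
      (measurableSet_lt measurable_snd measurable_fst.snd)
  · unfold hazardPow
    fun_prop

lemma hazardPow_pos (p : ℕ) {s y : ℝ} (h : cumHazard ν s < cumHazard ν y) :
    hazardPow ν p s y ≠ 0 := by
  have : 0 < cumHazard ν y - cumHazard ν s := sub_pos.2 h
  simp only [hazardPow, ne_eq, ENNReal.ofReal_eq_zero, not_le]
  positivity

lemma hazardPow_ne_top (p : ℕ) (s y : ℝ) : hazardPow ν p s y ≠ ⊤ := ENNReal.ofReal_ne_top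

variable [IsProbabilityMeasure ν]

/-- The conditional law of the record value number `a + p + 1` given those of number `a` and
`a + p + 2`. -/
noncomputable def recordCondKernel (ν : Measure ℝ) [IsProbabilityMeasure ν] (p : ℕ) :
    Kernel (ℝ × ℝ) ℝ :=
  Kernel.withDensity (Kernel.const (ℝ × ℝ) (hazardMeasure ν)) (recordCondDensity ν p)

lemma recordCondKernel_apply (p : ℕ) (q : ℝ × ℝ) :
    recordCondKernel ν p q = (hazardMeasure ν).withDensity (recordCondDensity ν p q) := by
  rw [recordCondKernel, Kernel.withDensity_apply _ (measurable_recordCondDensity p),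
    Kernel.const_apply]

lemma lintegral_recordCondKernel (p : ℕ) (q : ℝ × ℝ) {f : ℝ → ENNReal} (hf : Measurable f) :
    ∫⁻ w, f w ∂recordCondKernel ν p q =
      if q.1 < q.2 ∧ cumHazard ν q.1 < cumHazard ν q.2 then
        (hazardPow ν (p + 1) q.1 q.2)⁻¹ *
          ∫⁻ w in Ioo q.1 q.2, hazardPow ν p q.1 w * f w ∂hazardMeasure ν
      else 0 := by
  have hd : Measurable fun w => recordCondDensity ν p q w :=
    (measurable_recordCondDensity p).comp (f := fun w => (q, w)) measurable_prodMk_left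
  have hm : Measurable fun w => hazardPow ν p q.1 w * f w :=
    (measurable_hazardPow_right p q.1).mul hf
  rw [recordCondKernel_apply, lintegral_withDensity_eq_lintegral_mul _ hd hf]
  simp only [Pi.mul_apply]
  split_ifs with h
  · rw [← lintegral_const_mul _ hm, ← lintegral_indicator measurableSet_Ioo]
    refine lintegral_congr fun w => ?_
    by_cases hw : w ∈ Ioo q.1 q.2
    · simp only [recordCondDensity, h, hw, indicator_of_mem, and_self, if_true, mul_assoc]
    · simp only [recordCondDensity, hw, indicator_of_notMem, not_false_eq_true, and_false,
        if_false, zero_mul]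
  · simp only [recordCondDensity, h, false_and, if_false, zero_mul, lintegral_zero]

/-- The total mass is `1` where the density is normalizable and `0` at the other pairs, so the
kernel is finite but need not be Markov. -/
lemma isFiniteKernel_recordCondKernel (hG : Continuous (cdf ν)) (p : ℕ) :
    IsFiniteKernel (recordCondKernel ν p) := by
  refine ⟨1, ENNReal.one_lt_top, fun q => ?_⟩
  rw [← lintegral_one, lintegral_recordCondKernel p q measurable_const]
  split_ifs with h
  · simp only [mul_one]
    rw [lintegral_hazardPow hG p h.1
      (cdf_lt_one_of_cumHazard_pos ((cumHazard_nonneg _).trans_lt h.2)),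
      ENNReal.inv_mul_cancel (hazardPow_pos _ h.2) (hazardPow_ne_top _ _ _)]
  · exact zero_le_one

variable {Ω : Type*} [MeasurableSpace Ω] {μ : Measure Ω} [IsProbabilityMeasure μ]
  {Y : ℕ → Ω → ℝ}

lemma map_record_eq_compProd (hmeas : ∀ i, Measurable (Y i)) (hind : iIndepFun Y μ)
    (hlaw : ∀ i, μ.map (Y i) = ν) (hG : Continuous (cdf ν)) {a : ℕ} (ha : 1 ≤ a) (p : ℕ) :
    μ.map (fun ω => ((recordValue Y a ω, recordValue Y (a + p + 2) ω),
        recordValue Y (a + p + 1) ω)) =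
      μ.map (fun ω => (recordValue Y a ω, recordValue Y (a + p + 2) ω)) ⊗ₘ
        recordCondKernel ν p := by
  have := isFiniteKernel_recordCondKernel hG p (ν := ν)
  have hR := measurable_recordValue hmeas
  refine Measure.ext_of_lintegral _ fun F hF => ?_
  have hK : Measurable fun q : ℝ × ℝ => ∫⁻ w, F (q, w) ∂recordCondKernel ν p q :=
    hF.lintegral_kernel_prod_right'
  rw [Measure.lintegral_compProd hF, lintegral_map hF (((hR _).prodMk (hR _)).prodMk (hR _)),
    lintegral_map hK ((hR _).prodMk (hR _))]
  rw [(recordPairLaw hmeas hind hlaw hG ha p).lintegral_triple hmeas hind hlaw hG ha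
    (F := fun u w y => F ((u, y), w))
    (hF.comp (f := fun r : ℝ × ℝ × ℝ => ((r.1, r.2.2), r.2.1)) (by fun_prop))]
  rw [show a + p + 2 = a + (p + 1) + 1 by ring, recordPairLaw hmeas hind hlaw hG ha (p + 1)
    (fun s y => ∫⁻ w, F ((s, y), w) ∂recordCondKernel ν p (s, y)) hK]
  refine lintegral_congr fun ω => ?_
  congr 1
  generalize recordValue Y a ω = s
  refine setLIntegral_congr_fun_ae measurableSet_Ioi ?_
  filter_upwards [ae_cdf_mem_Ioo hG] with y hy hsy
  have hFy : Measurable fun w => F ((s, y), w) := hF.comp measurable_prodMk_left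
  rw [lintegral_recordCondKernel p (s, y) hFy]
  split_ifs with h
  · rw [← mul_assoc, ENNReal.mul_inv_cancel (hazardPow_pos _ h.2) (hazardPow_ne_top _ _ _),
      one_mul]
  -- If the hazard does not increase from `s` to `y`, the kernel vanishes and so does the integral
  -- over the intermediate record.
  · have hm : Measurable fun w => hazardPow ν p s w * F ((s, y), w) :=
      (measurable_hazardPow_right p s).mul hFy
    rw [mul_zero, lintegral_hazardMeasure_Ioo hG hsy hy.2 hm,
      Ioo_eq_empty fun hlt => h ⟨hsy, hlt⟩]
    simp

lemma integral_recordCondKernel (hG : Continuous (cdf ν)) (p : ℕ) {g : ℝ → ℝ}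
    (hg : AntitoneOn g (openSupport (cdf ν))) {s y : ℝ} (hs : s ∈ openSupport (cdf ν))
    (hy : y ∈ openSupport (cdf ν)) (hsy : s < y) (hH : cumHazard ν s < cumHazard ν y) :
    ∫ w, g w ∂recordCondKernel ν p (s, y) =
      (p + 1) / (cumHazard ν y - cumHazard ν s) ^ (p + 1) *
        ∫ h in cumHazard ν s..cumHazard ν y,
          g (hazardQuantile ν h) * (h - cumHazard ν s) ^ p := by
  have hord : (openSupport (cdf ν)).OrdConnected :=
    ⟨fun u hu v hv w hw => ⟨hu.1.trans_le (EReal.coe_le_coe_iff.2 hw.1),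
      (EReal.coe_le_coe_iff.2 hw.2).trans_lt hv.2⟩⟩
  have hsub : Ioo s y ⊆ openSupport (cdf ν) := Ioo_subset_Icc_self.trans (hord.out hs hy)
  have hd : Measurable fun w => recordCondDensity ν p (s, y) w :=
    (measurable_recordCondDensity p).comp (f := fun w => ((s, y), w)) measurable_prodMk_left
  have hpos : 0 < cumHazard ν y - cumHazard ν s := sub_pos.2 hH
  have hy1 := ((mem_openSupport_cdf_iff hG).1 hy).2
  have hIsub : Ioo (cumHazard ν s) (cumHazard ν y) ⊆ Ioi 0 :=
    fun h hh => (cumHazard_nonneg s).trans_lt hh.1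
  have hQ : AEMeasurable (hazardQuantile ν)
      (volume.restrict (Ioo (cumHazard ν s) (cumHazard ν y))) :=
    (aemeasurable_hazardQuantile hG).mono_measure (Measure.restrict_mono hIsub le_rfl)
  have hgm : AEMeasurable g ((hazardMeasure ν).restrict (Ioo s y)) :=
    aemeasurable_restrict_of_antitoneOn measurableSet_Ioo (hg.mono hsub)
  rw [recordCondKernel_apply, integral_withDensity_eq_integral_toReal_smul hd
    (ae_of_all _ fun w => ?_)]
  · have h1 : ∀ w, (recordCondDensity ν p (s, y) w).toReal • g w =
        (Ioo s y).indicator (fun w => (p + 1) / (cumHazard ν y - cumHazard ν s) ^ (p + 1) *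
          (g w * (cumHazard ν w - cumHazard ν s) ^ p)) w := by
      intro w
      by_cases hw : w ∈ Ioo s y
      · have h2 : 0 ≤ cumHazard ν w - cumHazard ν s :=
          sub_nonneg.2 (cumHazard_le_of_le hw.1.le
            ((monotone_cdf ν hw.2.le).trans_lt hy1))
        rw [indicator_of_mem hw, recordCondDensity, if_pos ⟨⟨hsy, hH⟩, hw⟩, ENNReal.toReal_mul,
          ENNReal.toReal_inv, hazardPow, hazardPow, ENNReal.toReal_ofReal (by positivity),
          ENNReal.toReal_ofReal (by positivity), Nat.factorial_succ, smul_eq_mul]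
        push_cast
        field_simp
      · rw [indicator_of_notMem hw, recordCondDensity, if_neg fun h => hw h.2]
        simp
    simp only [h1]
    rw [integral_indicator measurableSet_Ioo, integral_const_mul,
      hazardMeasure_restrict_Ioo hG hsy hy1, integral_map hQ, intervalIntegral.integral_of_le hH.le,
      integral_Ioc_eq_integral_Ioo]
    · congr 1
      refine setIntegral_congr_fun measurableSet_Ioo fun h hh => ?_
      rw [cumHazard_hazardQuantile hG (hIsub hh)]
    · rw [← hazardMeasure_restrict_Ioo hG hsy hy1]
      refine (hgm.mul (Measurable.aemeasurable ?_)).aestronglyMeasurable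
      have := measurable_cumHazard ν
      fun_prop
  · rw [recordCondDensity]
    split_ifs with h
    · exact ENNReal.mul_lt_top (ENNReal.inv_lt_top.2 (pos_iff_ne_zero.2 (hazardPow_pos _ hH)))
        ENNReal.ofReal_lt_top
    · exact ENNReal.zero_lt_top

theorem regression_record_ae (hmeas : ∀ i, Measurable (Y i)) (hind : iIndepFun Y μ)
    (hlaw : ∀ i, μ.map (Y i) = ν) (hG : Continuous (cdf ν)) {a : ℕ} (ha : 1 ≤ a) (p : ℕ)
    {g : ℝ → ℝ} (hg : AntitoneOn g (openSupport (cdf ν))) :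
    ∀ᵐ q ∂(μ.map fun ω => (recordValue Y a ω, recordValue Y (a + p + 2) ω)),
      q.1 ∈ openSupport (cdf ν) → q.2 ∈ openSupport (cdf ν) → q.1 < q.2 →
      cumHazard ν q.1 < cumHazard ν q.2 →
        regression μ g (recordValue Y (a + p + 1)) (recordValue Y a)
            (recordValue Y (a + p + 2)) q.1 q.2 =
          (p + 1) / (cumHazard ν q.2 - cumHazard ν q.1) ^ (p + 1) *
            ∫ h in cumHazard ν q.1..cumHazard ν q.2,
              g (hazardQuantile ν h) * (h - cumHazard ν q.1) ^ p := by
  have := isFiniteKernel_recordCondKernel hG p (ν := ν)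
  have hR := measurable_recordValue hmeas
  have h := condDistrib_ae_eq_of_measure_eq_compProd
    (fun ω => (recordValue Y a ω, recordValue Y (a + p + 2) ω)) (hR (a + p + 1)).aemeasurable
    (map_record_eq_compProd hmeas hind hlaw hG ha p)
  filter_upwards [h] with q hq h1 h2 h3 h4
  rw [regression, hq, integral_recordCondKernel hG p hg h1 h2 h3 h4]

/-- The joint density is positive where the hazard increases strictly, so null sets of the pair law
are null for `ν ⊗ ν` there. -/
lemma ae_ae_of_ae_map_record (hmeas : ∀ i, Measurable (Y i)) (hind : iIndepFun Y μ)
    (hlaw : ∀ i, μ.map (Y i) = ν) (hG : Continuous (cdf ν)) {a : ℕ} (ha : 1 ≤ a) (p : ℕ)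
    {P : ℝ × ℝ → Prop}
    (hP : ∀ᵐ q ∂(μ.map fun ω => (recordValue Y a ω, recordValue Y (a + p + 1) ω)), P q) :
    ∀ᵐ s ∂ν, ∀ᵐ y ∂ν, s < y → cumHazard ν s < cumHazard ν y → P (s, y) := by
  have hR := measurable_recordValue hmeas
  obtain ⟨N, hN, hNm, hN0⟩ := exists_measurable_superset_of_null (ae_iff.1 hP)
  have hind1 : Measurable (N.indicator (1 : ℝ × ℝ → ENNReal)) := measurable_one.indicator hNm
  have h := recordPairLaw hmeas hind hlaw hG ha p (fun s y => N.indicator 1 (s, y)) hind1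
  have hm2 : Measurable fun q : ℝ × ℝ => hazardPow ν p q.1 q.2 * N.indicator 1 (q.1, q.2) :=
    (measurable_hazardPow p).mul hind1
  have hm : Measurable fun s => (ν (Ioi s))⁻¹ *
      ∫⁻ y in Ioi s, hazardPow ν p s y * N.indicator 1 (s, y) ∂ν :=
    (measurable_measure_Ioi ν).inv.mul (measurable_lintegral_Ioi ν hm2 measurable_id)
  rw [← lintegral_map hind1 ((hR _).prodMk (hR _)), lintegral_indicator_one hNm, hN0,
    ← lintegral_map hm (hR a), eq_comm, lintegral_eq_zero_iff hm] at h
  filter_upwards [(absolutelyContinuous_map_recordValue hmeas hind hlaw hG ha).ae_le h] with s hs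
  rcases mul_eq_zero.1 hs with hs | hs
  · exact absurd hs (by simp)
  · have hms : Measurable fun y => hazardPow ν p s y * N.indicator 1 (s, y) :=
      (measurable_hazardPow_right p s).mul (hind1.comp measurable_prodMk_left)
    rw [lintegral_eq_zero_iff hms] at hs
    filter_upwards [(ae_restrict_iff' measurableSet_Ioi).1 hs] with y hy hsy hH
    by_contra hc
    have h1 := hy hsy
    rw [Pi.zero_apply, indicator_of_mem (hN hc)] at h1
    simp [hazardPow_pos p hH] at h1

end RecordKernel

/-! ### The integral equation and its affine solutions -/

section AffineEquation

open Set

/-- Points of equality are dense, so monotonicity squeezes `f v` between values of `C` on both sides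
of `v`. -/
lemma eqOn_of_antitoneOn_of_ae_eq {f C : ℝ → ℝ} {u : ℝ} (hf : AntitoneOn f (Ioi u))
    (hC : ContinuousOn C (Ioi u)) (hfC : ∀ᵐ v, u < v → f v = C v) : EqOn f C (Ioi u) := by
  have hd := Measure.dense_of_ae hfC
  intro v hv
  have hCv : Tendsto C (𝓝 v) (𝓝 (C v)) := hC.continuousAt (Ioi_mem_nhds hv)
  apply le_antisymm
  · refine ge_of_tendsto_of_frequently (hCv.mono_left (nhdsWithin_le_nhds (s := Iio v))) ?_
    refine ((nhdsLT_basis v).frequently_iff).2 fun i hi => ?_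
    obtain ⟨w, hw, hw1, hw2⟩ := hd.exists_between (max_lt hi (mem_Ioi.1 hv))
    have huw := (le_max_right _ _).trans_lt hw1
    exact ⟨w, ⟨(le_max_left _ _).trans_lt hw1, hw2⟩, (hf huw hv hw2.le).trans (hw huw).le⟩
  · refine le_of_tendsto_of_frequently (hCv.mono_left (nhdsWithin_le_nhds (s := Ioi v))) ?_
    refine ((nhdsGT_basis v).frequently_iff).2 fun i hi => ?_
    obtain ⟨w, hw, hw1, hw2⟩ := hd.exists_between hi
    have huw := (mem_Ioi.1 hv).trans hw1
    exact ⟨w, ⟨hw1, hw2⟩, (hw huw).ge.trans (hf hv huw hw1.le)⟩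

lemma integral_inv_affine_pow (p : ℕ) {α β u v : ℝ} (hβ : 0 ≤ β) (hu : 0 < α + β * u)
    (huv : u < v) :
    (p + 1) / (v - u) ^ (p + 1) * ∫ h in u..v, ((α + β * h) ^ (p + 2))⁻¹ * (h - u) ^ p =
      ((α + β * v) ^ (p + 1))⁻¹ * (α + β * u)⁻¹ := by
  have hT : ∀ h ∈ uIcc u v, 0 < α + β * h := fun h hh => by
    rw [uIcc_of_le huv.le] at hh
    nlinarith [mul_le_mul_of_nonneg_left hh.1 hβ]
  -- The derivative of `(h - u) / (α + β h)` is `(α + β u) / (α + β h) ^ 2`.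
  have hder : ∀ h ∈ uIcc u v, HasDerivAt
      (fun h => ((h - u) / (α + β * h)) ^ (p + 1) / ((p + 1) * (α + β * u)))
      (((α + β * h) ^ (p + 2))⁻¹ * (h - u) ^ p) h := fun h hh => by
    have h0 := (hT h hh).ne'
    have h1 : HasDerivAt (fun h => α + β * h) β h := by
      simpa using ((hasDerivAt_id h).const_mul β).const_add α
    have h2 := ((((hasDerivAt_id h).sub_const u).div h1 h0).pow (p + 1)).div_const
      ((p + 1) * (α + β * u))
    convert! h2 using 1
    simp only [id_eq, Pi.div_apply, Nat.add_sub_cancel, div_pow]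
    have : ((p : ℝ) + 1) ≠ 0 := by positivity
    push_cast
    field_simp
    ring
  rw [intervalIntegral.integral_eq_sub_of_hasDerivAt hder]
  · have hv := (hT v right_mem_uIcc).ne'
    have : v - u ≠ 0 := (sub_pos.2 huv).ne'
    have : ((p : ℝ) + 1) ≠ 0 := by positivity
    rw [sub_self, zero_div, zero_pow p.succ_ne_zero, zero_div, sub_zero, div_pow]
    field_simp
  · refine ContinuousOn.intervalIntegrable (ContinuousOn.mul (ContinuousOn.inv₀ (by fun_prop) ?_)
      (by fun_prop))
    exact fun h hh => (pow_pos (hT h hh) _).ne'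

lemma exists_affine_of_rays {θ : ℝ → ℝ}
    (h : ∀ a > 0, ∃ α β : ℝ, ∀ v, a ≤ v → θ v = α + β * v) :
    ∃ α β : ℝ, ∀ v, 0 < v → θ v = α + β * v := by
  obtain ⟨α, β, hαβ⟩ := h 1 one_pos
  refine ⟨α, β, fun v hv => ?_⟩
  obtain ⟨α', β', h'⟩ := h v hv
  have e1 := hαβ (max v 1) (le_max_right _ _)
  have e2 := hαβ (max v 1 + 1) ((le_max_right _ _).trans (by linarith))
  have e3 := h' (max v 1) (le_max_left _ _)
  have e4 := h' (max v 1 + 1) ((le_max_left _ _).trans (by linarith))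
  have hβ : β' = β := by linarith
  subst hβ
  rw [h' v le_rfl]
  linarith

/-- Regularity is bootstrapped at a good `u`: the integral is continuous in `v`, hence so is `θ`;
then the integral is differentiable, hence so is `θ`. Good points `u` are dense, which is all that
is used of them. -/
theorem exists_affine_of_ae_integral_eq (p : ℕ) {θ : ℝ → ℝ} (hpos : ∀ h, 0 < h → 0 < θ h)
    (hmono : StrictMonoOn θ (Ioi 0))
    (hθ : ∀ᵐ u, 0 < u → ∀ᵐ v, u < v →
      (p + 1) / (v - u) ^ (p + 1) * ∫ h in u..v, ((θ h) ^ (p + 2))⁻¹ * (h - u) ^ p =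
        ((θ v) ^ (p + 1))⁻¹ * (θ u)⁻¹) :
    ∃ α β : ℝ, 0 < β ∧ ∀ v, 0 < v → θ v = α + β * v := by
  have hanti : ∀ m : ℕ, AntitoneOn (fun h => ((θ h) ^ m)⁻¹) (Ioi 0) := fun m a ha b hb hab =>
    inv_anti₀ (pow_pos (hpos a ha) m)
      (pow_le_pow_left₀ (hpos a ha).le (hmono.monotoneOn ha hb hab) m)
  have hint : ∀ u v : ℝ, 0 < u → u ≤ v →
      IntervalIntegrable (fun h => ((θ h) ^ (p + 2))⁻¹ * (h - u) ^ p) volume u v := by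
    intro u v hu huv
    refine IntervalIntegrable.mul_continuousOn (AntitoneOn.intervalIntegrable ((hanti _).mono ?_))
      (by fun_prop)
    rw [uIcc_of_le huv]
    exact fun h hh => hu.trans_le hh.1
  -- the identity holds for every `v`
  have hall : ∀ᵐ u, 0 < u → ∀ v, u < v →
      ((θ v) ^ (p + 1))⁻¹ = θ u * (p + 1) / (v - u) ^ (p + 1) *
        ∫ h in u..v, ((θ h) ^ (p + 2))⁻¹ * (h - u) ^ p := by
    filter_upwards [hθ] with u hu hu0
    refine eqOn_of_antitoneOn_of_ae_eq ((hanti (p + 1)).mono (Ioi_subset_Ioi hu0.le)) ?_ ?_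
    · refine ContinuousOn.mul (ContinuousOn.div (by fun_prop) (by fun_prop) fun v hv =>
        (pow_pos (sub_pos.2 hv) _).ne') fun v hv => ?_
      have hc := intervalIntegral.continuousOn_primitive_interval'
        (hint u (v + 1) hu0 (by linarith [mem_Ioi.1 hv])) left_mem_uIcc
      rw [uIcc_of_le (by linarith [mem_Ioi.1 hv])] at hc
      exact (hc.continuousAt (Icc_mem_nhds hv (by linarith))).continuousWithinAt
    · filter_upwards [hu hu0] with v hv huv
      have h0 := (hpos u hu0).ne'
      rw [mul_div_assoc, mul_assoc, hv huv]
      field_simp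
  have hdense := Measure.dense_of_ae hall
  -- Continuity and differentiability pass from `θ ^ (-(p + 1))` to `θ` through this root.
  have hθφ : ∀ v, 0 < v → θ v = ((((θ v) ^ (p + 1))⁻¹)⁻¹) ^ (((p + 1 : ℕ) : ℝ)⁻¹) := fun v hv => by
    rw [inv_inv, Real.pow_rpow_inv_natCast (hpos v hv).le p.succ_ne_zero]
  -- at a good `u`, the integral is differentiable once `θ` is continuous
  have hcont : ∀ v, 0 < v → ContinuousAt θ v := by
    intro v hv
    obtain ⟨u, hu, hu0, huv⟩ := hdense.exists_between hv
    have hc := intervalIntegral.continuousOn_primitive_interval'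
      (hint u (v + 1) hu0 (by linarith)) left_mem_uIcc
    rw [uIcc_of_le (by linarith)] at hc
    have h1 := hc.continuousAt (Icc_mem_nhds huv (by linarith : v < v + 1))
    have h2 : ContinuousAt (fun v => θ u * (p + 1) / (v - u) ^ (p + 1) *
        ∫ h in u..v, ((θ h) ^ (p + 2))⁻¹ * (h - u) ^ p) v :=
      ContinuousAt.mul (ContinuousAt.div (by fun_prop) (by fun_prop)
        (pow_pos (sub_pos.2 huv) (p + 1)).ne') h1
    have h3 : ContinuousAt (fun v => ((θ v) ^ (p + 1))⁻¹) v :=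
      h2.congr (by filter_upwards [Ioi_mem_nhds huv] with w hw using (hu hu0 w hw).symm)
    have h4 := (h3.inv₀ (inv_ne_zero (pow_pos (hpos v hv) _).ne')).rpow_const
      (p := ((p + 1 : ℕ) : ℝ)⁻¹) (Or.inl (by simpa using (hpos v hv).ne'))
    exact h4.congr (by filter_upwards [Ioi_mem_nhds hv] with w hw using (hθφ w hw).symm)
  have hderiv : ∀ u v, (0 < u → ∀ v, u < v →
      ((θ v) ^ (p + 1))⁻¹ = θ u * (p + 1) / (v - u) ^ (p + 1) *
        ∫ h in u..v, ((θ h) ^ (p + 2))⁻¹ * (h - u) ^ p) → 0 < u → u < v →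
      DifferentiableAt ℝ θ v ∧ θ v - (v - u) * deriv θ v = θ u := by
    intro u v hu hu0 huv
    have hv : 0 < v := hu0.trans huv
    have hI : HasDerivAt (fun v => ∫ h in u..v, ((θ h) ^ (p + 2))⁻¹ * (h - u) ^ p)
        (((θ v) ^ (p + 2))⁻¹ * (v - u) ^ p) v := by
      refine intervalIntegral.integral_hasDerivAt_right (hint u v hu0 huv.le) ?_ ?_
      · refine ContinuousOn.stronglyMeasurableAtFilter isOpen_Ioi (s := Ioi 0) ?_ v hv
        intro w hw
        exact (((hcont w hw).pow _).inv₀ (pow_pos (hpos w hw) _).ne').continuousWithinAt.mul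
          (by fun_prop)
      · exact ((((hcont v hv).pow _).inv₀ (pow_pos (hpos v hv) _).ne')).mul (by fun_prop)
    have hd2 : DifferentiableAt ℝ (fun v => θ u * (p + 1) / (v - u) ^ (p + 1) *
        ∫ h in u..v, ((θ h) ^ (p + 2))⁻¹ * (h - u) ^ p) v :=
      DifferentiableAt.mul (DifferentiableAt.div (by fun_prop) (by fun_prop)
        (pow_pos (sub_pos.2 huv) (p + 1)).ne') hI.differentiableAt
    have hd3 : DifferentiableAt ℝ (fun v => ((θ v) ^ (p + 1))⁻¹) v :=
      hd2.congr_of_eventuallyEq (by filter_upwards [Ioi_mem_nhds huv] with w hw using hu hu0 w hw)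
    have hd : DifferentiableAt ℝ θ v :=
      ((hd3.inv (inv_ne_zero (pow_pos (hpos v hv) _).ne')).rpow_const
        (p := ((p + 1 : ℕ) : ℝ)⁻¹) (Or.inl (by simpa using (hpos v hv).ne'))).congr_of_eventuallyEq
        (by filter_upwards [Ioi_mem_nhds hv] with w hw using hθφ w hw)
    refine ⟨hd, ?_⟩
    have hL := (((hasDerivAt_id v).sub_const u).div hd.hasDerivAt (hpos v hv).ne').pow (p + 1)
    have hR := hI.const_mul (θ u * (p + 1))
    -- In this form the integral stands alone, so comparing derivatives eliminates it.
    have heq : (((fun x => id x - u) / θ) ^ (p + 1)) =ᶠ[𝓝 v] fun v => θ u * (p + 1) *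
        ∫ h in u..v, ((θ h) ^ (p + 2))⁻¹ * (h - u) ^ p := by
      filter_upwards [Ioi_mem_nhds huv] with w hw
      have h1 := hu hu0 w hw
      have h2 : (w - u) ^ (p + 1) ≠ 0 := (pow_pos (sub_pos.2 hw) _).ne'
      simp only [Pi.pow_apply, Pi.div_apply, id_eq, div_pow]
      rw [div_eq_mul_inv, h1]
      field_simp
    have hfin := (hR.congr_of_eventuallyEq heq).unique hL
    have h0 := (hpos v hv).ne'
    have h2 : (v - u) ≠ 0 := (sub_pos.2 huv).ne'
    have h3 : ((p : ℝ) + 1) ≠ 0 := by positivity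
    simp only [Pi.div_apply, id_eq, Nat.add_sub_cancel, div_pow] at hfin
    push_cast at hfin
    have h4 : (p + 1) * (v - u) ^ p / θ v ^ (p + 2) * (θ v - (v - u) * deriv θ v) =
        (p + 1) * (v - u) ^ p / θ v ^ (p + 2) * θ u := by
      have e1 : (p + 1) * (v - u) ^ p / θ v ^ (p + 2) * θ u =
        θ u * (p + 1) * ((θ v ^ (p + 2))⁻¹ * (v - u) ^ p) := by ring
      rw [e1, hfin]
      field_simp
      ring
    exact mul_left_cancel₀ (by positivity) h4
  have haff : ∀ a > 0, ∃ α β : ℝ, ∀ v, a ≤ v → θ v = α + β * v := by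
    intro a ha
    -- Both base points lie below `a`, so both tangent relations hold for all `v ≥ a`; their
    -- difference fixes `θ' v` as the slope between them.
    obtain ⟨u₂, hg₂, h₂, h₂a⟩ := hdense.exists_between ha
    obtain ⟨u₁, hg₁, h₁, h₁₂⟩ := hdense.exists_between h₂
    refine ⟨θ u₂ - (θ u₂ - θ u₁) / (u₂ - u₁) * u₂, (θ u₂ - θ u₁) / (u₂ - u₁), fun v hv => ?_⟩
    have e1 := (hderiv u₁ v hg₁ h₁ (by linarith)).2
    have e2 := (hderiv u₂ v hg₂ h₂ (by linarith)).2
    have hne : u₂ - u₁ ≠ 0 := (sub_pos.2 h₁₂).ne'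
    have e3 : (θ u₂ - θ u₁) / (u₂ - u₁) = deriv θ v := by
      rw [div_eq_iff hne, ← e1, ← e2]; ring
    rw [e3]
    linarith
  obtain ⟨α, β, h⟩ := exists_affine_of_rays haff
  refine ⟨α, β, ?_, h⟩
  have := hmono (mem_Ioi.2 one_pos) (mem_Ioi.2 two_pos) one_lt_two
  rw [h 1 one_pos, h 2 two_pos] at this
  linarith

end AffineEquation

/-! ### Passage between the quantile scale and the original scale -/

section Characterization

open Set

variable {ν : Measure ℝ}

/-- The exponential density is positive on `(0, ∞)`, so its null sets there are Lebesgue null. -/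
lemma ae_hazardQuantile_of_ae [IsProbabilityMeasure ν] (hG : Continuous (cdf ν)) {P : ℝ → Prop}
    (hP : ∀ᵐ y ∂ν, P y) : ∀ᵐ h, 0 < h → P (hazardQuantile ν h) := by
  rw [← map_hazardQuantile_expMeasure hG] at hP
  have h := ae_of_ae_map (aemeasurable_hazardQuantile_expMeasure hG) hP
  rw [expMeasure_one_eq, ae_withDensity_iff (by fun_prop),
    ae_restrict_iff' measurableSet_Ioi] at h
  filter_upwards [h] with x hx h0
  exact hx h0 (by simp [Real.exp_pos])

lemma tendsto_hazardQuantile_rightOf (hG : Continuous (cdf ν)) :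
    Tendsto (hazardQuantile ν) (𝓝[>] 0) (rightOf (leftEnd (cdf ν))) := by
  have hmem : ∀ᶠ h in 𝓝[>] (0 : ℝ), leftEnd (cdf ν) < (hazardQuantile ν h : EReal) := by
    filter_upwards [self_mem_nhdsWithin] with h hh
    exact (hazardQuantile_mem_openSupport hG hh).1
  refine tendsto_comap_iff.2 (tendsto_nhdsWithin_iff.2 ⟨tendsto_order.2 ⟨fun b hb => ?_,
    fun b hb => ?_⟩, hmem⟩)
  · filter_upwards [hmem] with h hh using hb.trans hh
  · obtain ⟨_, ⟨y, hy, rfl⟩, hyb⟩ := sInf_lt_iff.1 hb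
    have hlim : Tendsto (fun h : ℝ => 1 - Real.exp (-h)) (𝓝[>] 0) (𝓝 0) := by
      have : Continuous fun h : ℝ => 1 - Real.exp (-h) := by fun_prop
      simpa using (this.tendsto 0).mono_left nhdsWithin_le_nhds
    filter_upwards [hlim.eventually_lt_const hy, self_mem_nhdsWithin] with h h1 h2
    rw [← cdf_hazardQuantile hG h2] at h1
    exact (EReal.coe_lt_coe_iff.2 ((monotone_cdf ν).reflect_lt h1)).trans hyb

lemma cumHazard_pos_of_mem (hG : Continuous (cdf ν)) {y : ℝ} (hy : y ∈ openSupport (cdf ν)) :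
    0 < cumHazard ν y := by
  obtain ⟨h0, h1⟩ := (mem_openSupport_cdf_iff hG).1 hy
  exact neg_pos.2 (Real.log_neg (by linarith) (by linarith))

/-- If a monotone function is affine along the quantiles, then it is an affine function of the
cumulative hazard function. -/
lemma eq_affine_cumHazard (hG : Continuous (cdf ν)) {T : ℝ → ℝ}
    (hT : MonotoneOn T (openSupport (cdf ν))) {α β : ℝ}
    (h : ∀ x, 0 < x → T (hazardQuantile ν x) = α + β * x) {y : ℝ}
    (hy : y ∈ openSupport (cdf ν)) : T y = α + β * cumHazard ν y := by
  have hpos := cumHazard_pos_of_mem hG hy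
  have hlim : Tendsto (fun x => α + β * x) (𝓝 (cumHazard ν y)) (𝓝 (α + β * cumHazard ν y)) := by
    have : Continuous fun x => α + β * x := by fun_prop
    exact this.tendsto _
  -- The point `y` need not be a value of `Q`, so `T y` is squeezed between quantiles at levels just
  -- above and just below `H y`.
  apply le_antisymm
  · refine ge_of_tendsto (hlim.mono_left (nhdsWithin_le_nhds (s := Ioi (cumHazard ν y)))) ?_
    filter_upwards [self_mem_nhdsWithin] with x hx
    have hx0 : 0 < x := hpos.trans hx
    rw [← h x hx0]
    exact hT hy (hazardQuantile_mem_openSupport hG hx0)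
      (lt_hazardQuantile_of_lt hG hx0 ((mem_openSupport_cdf_iff hG).1 hy).2 hx).le
  · refine le_of_tendsto (hlim.mono_left (nhdsWithin_le_nhds (s := Iio (cumHazard ν y)))) ?_
    filter_upwards [self_mem_nhdsWithin, nhdsWithin_le_nhds (Ioi_mem_nhds hpos)] with x hx hx0
    rw [← h x hx0]
    exact hT (hazardQuantile_mem_openSupport hG hx0) hy (hazardQuantile_lt_of_lt hG hx0 hx).le

lemma rpow_neg_inv_facts (p : ℕ) {x : ℝ} (hx : 0 < x) :
    ((x ^ (-1 / (((p + 1 : ℕ) : ℝ) + 1))) ^ (p + 2))⁻¹ = x ∧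
    ((x ^ (-1 / (((p + 1 : ℕ) : ℝ) + 1))) ^ (p + 1))⁻¹ =
      x ^ (((p + 1 : ℕ) : ℝ) / (((p + 1 : ℕ) : ℝ) + 1)) ∧
    (x ^ (-1 / (((p + 1 : ℕ) : ℝ) + 1)))⁻¹ = x ^ (1 / (((p + 1 : ℕ) : ℝ) + 1)) := by
  have hk : ((p : ℝ) + 1 + 1) ≠ 0 := by positivity
  refine ⟨?_, ?_, ?_⟩
  · rw [← Real.rpow_natCast, ← Real.rpow_mul hx.le, ← Real.rpow_neg hx.le]
    convert! Real.rpow_one x using 2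
    push_cast
    field_simp
    ring
  · rw [← Real.rpow_natCast, ← Real.rpow_mul hx.le, ← Real.rpow_neg hx.le]
    congr 1
    push_cast
    field_simp
  · rw [← Real.rpow_neg hx.le]
    congr 1
    field_simp

end Characterization

/-! ### The characterization theorem -/

theorem corollary2 {Ω : Type*} [MeasurableSpace Ω] (μ : Measure Ω) [IsProbabilityMeasure μ]
    -- independent copies `Y 0, Y 1, …` of a variable with law `ν` and continuous d.f. `cdf ν`
    (Y : ℕ → Ω → ℝ) (ν : Measure ℝ) [IsProbabilityMeasure ν]
    (hmeas : ∀ i, Measurable (Y i)) (hind : iIndepFun Y μ) (hlaw : ∀ i, μ.map (Y i) = ν)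
    (hG : Continuous (cdf ν))
    (n k : ℕ) (hk : 1 ≤ k) (hkn : k ≤ n - 1)
    -- `g` is positive and strictly decreasing, and `T = g ^ (-1 / (k + 1))` is continuous with
    -- `T(l+) = τ` finite and `T(r-) = ∞`
    (g : ℝ → ℝ) (hpos : ∀ y ∈ openSupport (cdf ν), 0 < g y)
    (hanti : StrictAntiOn g (openSupport (cdf ν)))
    (hcont : ContinuousOn (fun y => g y ^ (-1 / ((k : ℝ) + 1))) (openSupport (cdf ν)))
    (τ : ℝ)
    (hτ : Tendsto (fun y => g y ^ (-1 / ((k : ℝ) + 1))) (rightOf (leftEnd (cdf ν))) (𝓝 τ))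
    (htop : Tendsto (fun y => g y ^ (-1 / ((k : ℝ) + 1))) (leftOf (rightEnd (cdf ν))) atTop) :
    (∀ᵐ p ∂(μ.map (fun ω => (recordValue Y (n - k) ω, recordValue Y (n + 1) ω))),
      leftEnd (cdf ν) < (p.1 : EReal) → p.1 < p.2 → (p.2 : EReal) < rightEnd (cdf ν) →
        regression μ g (recordValue Y n) (recordValue Y (n - k)) (recordValue Y (n + 1)) p.1 p.2
          = g p.2 ^ ((k : ℝ) / ((k : ℝ) + 1)) * g p.1 ^ (1 / ((k : ℝ) + 1)))
    ↔
    (∃ c : ℝ, 0 < c ∧ ∀ y ∈ openSupport (cdf ν),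
      cdf ν y = 1 - Real.exp (-c * (g y ^ (-1 / ((k : ℝ) + 1)) - τ))) := by
  obtain ⟨p, rfl⟩ := Nat.exists_eq_add_of_le' hk
  obtain ⟨a, ha, rfl⟩ : ∃ a, 1 ≤ a ∧ n = a + p + 1 := ⟨n - (p + 1), by omega, by omega⟩
  rw [show a + p + 1 - (p + 1) = a by omega]
  set T : ℝ → ℝ := fun y => g y ^ (-1 / (((p + 1 : ℕ) : ℝ) + 1)) with hTdef
  have hTpos : ∀ y ∈ openSupport (cdf ν), 0 < T y := fun y hy => Real.rpow_pos_of_pos (hpos y hy) _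
  have hTmono : StrictMonoOn T (openSupport (cdf ν)) := fun x hx y hy hxy =>
    Real.rpow_lt_rpow_of_neg (hpos y hy) (hanti hx hy hxy)
      (div_neg_of_neg_of_pos (by norm_num) (by positivity))
  have hgT : ∀ y ∈ openSupport (cdf ν), g y = (T y ^ (p + 2))⁻¹ := fun y hy =>
    ((rpow_neg_inv_facts p (hpos y hy)).1).symm
  have hrhs : ∀ s ∈ openSupport (cdf ν), ∀ t ∈ openSupport (cdf ν),
      g t ^ (((p + 1 : ℕ) : ℝ) / (((p + 1 : ℕ) : ℝ) + 1)) * g s ^ (1 / (((p + 1 : ℕ) : ℝ) + 1)) =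
        (T t ^ (p + 1))⁻¹ * (T s)⁻¹ := fun s hs t ht => by
    rw [← (rpow_neg_inv_facts p (hpos t ht)).2.1, ← (rpow_neg_inv_facts p (hpos s hs)).2.2]
  have hQmem : ∀ h, 0 < h → hazardQuantile ν h ∈ openSupport (cdf ν) := fun h hh =>
    hazardQuantile_mem_openSupport hG hh
  have hreg := regression_record_ae hmeas hind hlaw hG ha p hanti.antitoneOn
  constructor
  · intro hE
    have hboth : ∀ᵐ q ∂(μ.map fun ω => (recordValue Y a ω, recordValue Y (a + p + 2) ω)),
        q.1 ∈ openSupport (cdf ν) → q.2 ∈ openSupport (cdf ν) → q.1 < q.2 →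
        cumHazard ν q.1 < cumHazard ν q.2 →
          (p + 1) / (cumHazard ν q.2 - cumHazard ν q.1) ^ (p + 1) *
            ∫ h in cumHazard ν q.1..cumHazard ν q.2,
              g (hazardQuantile ν h) * (h - cumHazard ν q.1) ^ p =
            (T q.2 ^ (p + 1))⁻¹ * (T q.1)⁻¹ := by
      filter_upwards [hreg, hE] with q h1 h2 hs ht hst hH
      rw [← h1 hs ht hst hH, ← hrhs _ hs _ ht]
      exact h2 hs.1 hst ht.2
    -- The conditioning records are numbers `a` and `a + (p + 1) + 1`, hence the index `p + 1`.
    have hprod := ae_ae_of_ae_map_record hmeas hind hlaw hG ha (p + 1) hboth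
    have hQ : ∀ᵐ u, 0 < u → ∀ᵐ v, u < v →
        (p + 1) / (v - u) ^ (p + 1) *
            ∫ h in u..v, ((T (hazardQuantile ν h)) ^ (p + 2))⁻¹ * (h - u) ^ p =
          ((T (hazardQuantile ν v)) ^ (p + 1))⁻¹ * (T (hazardQuantile ν u))⁻¹ := by
      filter_upwards [ae_hazardQuantile_of_ae hG hprod] with u hu hu0
      filter_upwards [ae_hazardQuantile_of_ae hG (hu hu0)] with v hv huv
      have hv0 := hu0.trans huv
      have hlt := strictMonoOn_hazardQuantile hG hu0 hv0 huv
      simp only [cumHazard_hazardQuantile hG hu0, cumHazard_hazardQuantile hG hv0] at hv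
      rw [← hv hv0 hlt huv (hQmem u hu0) (hQmem v hv0) hlt huv]
      congr 1
      refine intervalIntegral.integral_congr fun h hh => ?_
      rw [Set.uIcc_of_le huv.le] at hh
      rw [← hgT _ (hQmem h (hu0.trans_le hh.1))]
    obtain ⟨α, β, hβ, hθ⟩ := exists_affine_of_ae_integral_eq p
      (θ := fun h => T (hazardQuantile ν h)) (fun h hh => hTpos _ (hQmem h hh))
      (fun x hx y hy hxy => hTmono (hQmem x hx) (hQmem y hy)
        (strictMonoOn_hazardQuantile hG hx hy hxy)) hQ
    -- As `h → 0+` the quantile tends to the left extremity, where `T` has limit `τ`.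
    have hα : τ = α := by
      refine tendsto_nhds_unique (hτ.comp (tendsto_hazardQuantile_rightOf hG)) ?_
      have hc : Continuous fun x => α + β * x := by fun_prop
      have hl : Tendsto (fun x => α + β * x) (𝓝[>] 0) (𝓝 α) := by
        simpa using (hc.tendsto 0).mono_left nhdsWithin_le_nhds
      refine hl.congr' ?_
      filter_upwards [self_mem_nhdsWithin] with x hx using (hθ x hx).symm
    refine ⟨β⁻¹, inv_pos.2 hβ, fun y hy => ?_⟩
    have hTy : T y = α + β * cumHazard ν y := eq_affine_cumHazard hG hTmono.monotoneOn hθ hy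
    change cdf ν y = 1 - Real.exp (-β⁻¹ * (T y - τ))
    rw [hTy, hα, add_sub_cancel_left, neg_mul, inv_mul_cancel_left₀ hβ.ne',
      exp_neg_cumHazard ((mem_openSupport_cdf_iff hG).1 hy).2, sub_sub_cancel]
  · rintro ⟨c, hc, hF⟩
    have hH : ∀ y ∈ openSupport (cdf ν), T y = τ + c⁻¹ * cumHazard ν y := fun y hy => by
      have h1 : cumHazard ν y = c * (T y - τ) := by
        rw [cumHazard, hF y hy, sub_sub_cancel, Real.log_exp, neg_mul, neg_neg]
      rw [h1, inv_mul_cancel_left₀ hc.ne', add_sub_cancel]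
    filter_upwards [hreg] with q hq h1 hst h2
    have hs : q.1 ∈ openSupport (cdf ν) := ⟨h1, (EReal.coe_lt_coe_iff.2 hst).trans h2⟩
    have ht : q.2 ∈ openSupport (cdf ν) := ⟨h1.trans (EReal.coe_lt_coe_iff.2 hst), h2⟩
    -- Here `H` cannot be flat, since `T` is strictly increasing and affine in `H`.
    have hlt : cumHazard ν q.1 < cumHazard ν q.2 := by
      have := hTmono hs ht hst
      rw [hH _ hs, hH _ ht] at this
      exact lt_of_mul_lt_mul_left (by linarith) (inv_pos.2 hc).le
    rw [hrhs _ hs _ ht, hH _ hs, hH _ ht, ← integral_inv_affine_pow p (inv_pos.2 hc).le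
      ((hH _ hs) ▸ hTpos _ hs) hlt]
    refine (hq hs ht hst hlt).trans ?_
    congr 1
    refine intervalIntegral.integral_congr fun h hh => ?_
    rw [Set.uIcc_of_le hlt.le] at hh
    have hh0 := (cumHazard_pos_of_mem hG hs).trans_le hh.1
    rw [hgT _ (hQmem h hh0), hH _ (hQmem h hh0), cumHazard_hazardQuantile hG hh0]
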